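/- Let $X_1,X_2,\dots$ be i.i.d. real random variables with a bounded density $f$, and let $x_0\in\mathbb R$ be a point at which $f$ is positive and four times continuously differentiable (in a neighbourhood of $x_0$). Let $K:\mathbb R\to[0,\infty)$ be a symmetric, bounded kernel with $\int K=1$, $\mu_2=\int u^2K(u)\,du<\infty$, $\int K(u)^2\,du<\infty$ and $\int u^4K(u)\,du<\infty$. For $h>0$ put $$\hat f_h(x_0)=(nh)^{-1}\sum_{i=1}^nK\big((X_i-x_0)/h\big),\qquad \sigma_h^2=nh\,\mathrm{Var}\big(\hat f_h(x_0)\big).$$ For $b\ge1$ let $J_1,\dots,J_b$ be independent random indices, uniform on $\{1,\dots,n\}$ and independent of $(X_1,\dots,X_n)$. For $k>0$ put $\hat f^*_{b,1,k}=(bk)^{-1}\sum_{i=1}^bK\big((X_{J_i}-x_0)/k\big)$, and for $\tau\ge0$ and $k_1,k_2,k_3>0$ put $$T^*_{b,1,\tau,k_1,k_2,k_3}=(bk_1)^{1/2}\Big\{\hat f^*_{b,1,k_1}-\mathbb E\big[\hat f^*_{b,1,k_1}\big|X_1,\dots,X_n\big]\Big\}+\tau\Big\{\mathbb E\big[\hat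 f^*_{b,1,k_2}\big|X_1,\dots,X_n\big]-\hat f_{k_3}(x_0)\Big\}$$ (this is the block bootstrap statistic with block length $\ell=1$). Let $b,\tau,k_1,k_2,k_3$ depend on $n$ (non-randomly), and suppose that, as $n\to\infty$, $b=O(n)$, $b\to\infty$, $(bk_1)^{-1}+k_1=o(1)$ and $(nk_j)^{-1}+k_j=o(1)$ for $j=2,3$. Then, for every fixed $y\in\mathbb R$, $$\mathbb P\big(T^*_{b,1,\tau,k_1,k_2,k_3}\le y\,\big|\,X_1,\dots,X_n\big)=\Phi\left(\frac{y-\tau(k_2^2-k_3^2)f''(x_0)\mu_2/2}{\sigma_{k_1}}\right)+O_p\Big\{(bk_1)^{-1/2}+\tau\big[k_2^4+k_3^4+(nk_2)^{-1/2}+(nk_3)^{-1/2}\big]\Big\},$$ where $\Phi$ is the standard normal distribution function. -/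

import Mathlib

open MeasureTheory ProbabilityTheory Filter Topology Asymptotics

noncomputable section

namespace KernelBootstrap

/-- A univariate, non-negative, symmetric, bounded kernel function with
`∫ K = 1`, `∫ u² K(u) du < ∞` and `∫ K² < ∞`. -/
structure IsKernel (K : ℝ → ℝ) : Prop where
  measurable : Measurable K
  nonneg : ∀ u, 0 ≤ K u
  symmetric : ∀ u, K (-u) = K u
  bounded : ∃ M, ∀ u, K u ≤ M
  integral_eq_one : ∫ u, K u = 1
  integrable_sq_mul : Integrable (fun u => u ^ 2 * K u)
  integrable_sq : Integrable (fun u => K u ^ 2)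

/-- The second moment `μ₂ = ∫ u² K(u) du` of the kernel. -/
def mu2 (K : ℝ → ℝ) : ℝ := ∫ u, u ^ 2 * K u

/-- The distribution function `Φ` of the standard normal law. -/
def Phi (x : ℝ) : ℝ := cdf (gaussianReal 0 1) x

variable {Ω : Type*} [MeasurableSpace Ω]

/-- The kernel density estimator at `x₀` with bandwidth `h`, based on `X₁, …, Xₙ`. -/
def kde (K : ℝ → ℝ) (x₀ : ℝ) (X : ℕ → Ω → ℝ) (n : ℕ) (h : ℝ) (ω : Ω) : ℝ :=
  (n * h)⁻¹ * ∑ i ∈ Finset.Icc 1 n, K ((X i ω - x₀) / h)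

/-- `σ_h`, where `σ_h² = n h Var(f̂_h(x₀))`. -/
def sigma (P : Measure Ω) (K : ℝ → ℝ) (x₀ : ℝ) (X : ℕ → Ω → ℝ) (n : ℕ) (h : ℝ) : ℝ :=
  √(n * h * variance (kde K x₀ X n h) P)

/-- The sample `(X₁, …, Xₙ)` as a random vector. -/
def sample (X : ℕ → Ω → ℝ) (n : ℕ) (ω : Ω) : Fin n → ℝ := fun i => X (i + 1) ω

/-- The σ-algebra generated by `X₁, …, Xₙ`. -/
abbrev sampleSigma (X : ℕ → Ω → ℝ) (n : ℕ) : MeasurableSpace Ω :=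
  MeasurableSpace.comap (sample X n) inferInstance

/-- `J₁, …, J_b` are independent random indices, uniform on `{1, …, n - ℓ + 1}`, drawn
independently of the sample `(X₁, …, Xₙ)`. -/
structure IsBlockIndices (P : Measure Ω) (X : ℕ → Ω → ℝ) (n ℓ b : ℕ)
    (J : Fin b → Ω → ℕ) : Prop where
  measurable : ∀ i, Measurable (J i)
  uniform : ∀ i, P.map (J i) = uniformOn (Set.Icc 1 (n - ℓ + 1))
  independent : iIndepFun J P
  indep_sample : IndepFun (fun ω i => J i ω) (sample X n) P

/-- `U_{i,k,ℓ}`: the kernel density estimator of bandwidth `k` on the block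
`X_i, …, X_{i+ℓ-1}`. -/
def blockKde (K : ℝ → ℝ) (x₀ : ℝ) (X : ℕ → Ω → ℝ) (ℓ : ℕ) (k : ℝ) (i : ℕ) (ω : Ω) : ℝ :=
  (ℓ * k)⁻¹ * ∑ t ∈ Finset.range ℓ, K ((X (i + t) ω - x₀) / k)

/-- The bootstrap kernel density estimator `f̂*_{b,ℓ,k} = b⁻¹ ∑ U_{J_i,k,ℓ}`. -/
def bootKde (K : ℝ → ℝ) (x₀ : ℝ) (X : ℕ → Ω → ℝ) (ℓ : ℕ) {b : ℕ} (J : Fin b → Ω → ℕ)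
    (k : ℝ) (ω : Ω) : ℝ :=
  (b : ℝ)⁻¹ * ∑ i, blockKde K x₀ X ℓ k (J i ω) ω

/-- The bootstrap statistic `T*_{b,ℓ,τ,k₁,k₂,k₃}`; the conditional expectations are given
`X₁, …, Xₙ`. -/
def bootStat (P : Measure Ω) (K : ℝ → ℝ) (x₀ : ℝ) (X : ℕ → Ω → ℝ) (n ℓ : ℕ) {b : ℕ}
    (J : Fin b → Ω → ℕ) (τ k₁ k₂ k₃ : ℝ) (ω : Ω) : ℝ :=
  √(b * ℓ * k₁) *
      (bootKde K x₀ X ℓ J k₁ ω - (P[bootKde K x₀ X ℓ J k₁ | sampleSigma X n]) ω) +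
    τ * ((P[bootKde K x₀ X ℓ J k₂ | sampleSigma X n]) ω - kde K x₀ X n k₃ ω)

/-- The conditional probability `P(T*_{b,ℓ,τ,k₁,k₂,k₃} ≤ y | X₁, …, Xₙ)`. -/
def bootCDF (P : Measure Ω) (K : ℝ → ℝ) (x₀ : ℝ) (X : ℕ → Ω → ℝ) (n ℓ : ℕ) {b : ℕ}
    (J : Fin b → Ω → ℕ) (τ k₁ k₂ k₃ y : ℝ) : Ω → ℝ :=
  P⟦{ω | bootStat P K x₀ X n ℓ J τ k₁ k₂ k₃ ω ≤ y} | sampleSigma X n⟧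

/-- `R n = O_p(a n)` as `n → ∞`. -/
def IsBigOInProb (P : Measure Ω) (R : ℕ → Ω → ℝ) (a : ℕ → ℝ) : Prop :=
  ∀ ε : ℝ, 0 < ε → ∃ C : ℝ, 0 < C ∧
    ∀ᶠ n in atTop, P.real {ω | C * a n < |R n ω|} ≤ ε

end KernelBootstrap

end

open KernelBootstrap

/-! Freeze the sample. The drift `τ (f̂_{k₂} - f̂_{k₃})` becomes a constant, because the bootstrap
mean is the estimator itself. The remaining term is a normalised sum of `b` independent uniform
draws from the values `K((X_m - x₀)/k₁)`. Its conditional variance is `s² = kde (K²) - k₁ (kde K)²`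
at bandwidth `k₁`. After scaling to total variance one, each summand is at most `B / (√(b k₁) s)`,
so Berry–Esseen gives an error of order `(b k₁)^(-1/2)` as long as `s` stays away from zero
(`ae_abs_bootCDF_sub_Phi_le`).

It remains to replace random quantities by deterministic ones. Chebyshev puts each kernel average
within `O_p((n h)^(-1/2))` of its mean (`measureReal_lt_abs_kde_sub_le`), and `σ_{k₁}²` is exactly
`s²` with averages replaced by means (`variance_kde`). The variance therefore costs `(n k₁)^(-1/2)`,
which `b = O(n)` turns into `(b k₁)^(-1/2)`. In the drift, the symmetry of `K` removes the odd
Taylor terms and leaves a bias error of order `k₂⁴ + k₃⁴` (`abs_kernelMean_sub_le`). Finally `Φ` is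
Lipschitz in the drift, and `Φ(a/s)` is Lipschitz in `s` uniformly in `a`, so the drift need not
stay bounded.

Berry–Esseen is proved by Stein's method. For summands bounded by `d`, the leave-one-out sum differs
from the full sum by at most `d`. Moving the threshold by `2d` absorbs this difference, so no
separate concentration inequality is needed. -/

namespace KernelBootstrap

/-! ### The standard normal distribution function -/

/-- The standard normal density. -/
noncomputable def phi (x : ℝ) : ℝ := gaussianPDFReal 0 1 x

lemma phi_eq (x : ℝ) : phi x = (√(2 * Real.pi))⁻¹ * Real.exp (-x ^ 2 / 2) := by
  simp [phi, gaussianPDFReal]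

lemma phi_pos (x : ℝ) : 0 < phi x := gaussianPDFReal_pos _ _ _ one_ne_zero

lemma integrable_phi : Integrable phi := integrable_gaussianPDFReal 0 1

lemma continuous_phi : Continuous phi := by
  have : phi = fun x => (√(2 * Real.pi))⁻¹ * Real.exp (-x ^ 2 / 2) := funext phi_eq
  rw [this]; fun_prop

lemma phi_neg (x : ℝ) : phi (-x) = phi x := by simp [phi_eq]

lemma hasDerivAt_phi (x : ℝ) : HasDerivAt phi (-x * phi x) x := by
  have : phi = fun x => (√(2 * Real.pi))⁻¹ * Real.exp (-x ^ 2 / 2) := funext phi_eq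
  rw [phi_eq, this]
  have h1 : HasDerivAt (fun x : ℝ => -x ^ 2 / 2) (-x) x := by
    have := ((hasDerivAt_id x).pow 2).neg.div_const 2
    refine (this.congr_deriv ?_).congr_of_eventuallyEq (.of_forall fun y => by simp)
    norm_num
    ring
  refine (h1.exp.const_mul (√(2 * Real.pi))⁻¹).congr_deriv ?_
  ring

lemma phi_le_one (x : ℝ) : phi x ≤ 1 := by
  rw [phi_eq]
  have h1 : Real.exp (-x ^ 2 / 2) ≤ 1 := Real.exp_le_one_iff.2 (by nlinarith [sq_nonneg x])
  have h2 : 1 ≤ √(2 * Real.pi) := by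
    rw [Real.one_le_sqrt]; nlinarith [Real.pi_gt_three]
  have h3 : (√(2 * Real.pi))⁻¹ ≤ 1 := inv_le_one_of_one_le₀ h2
  exact mul_le_one₀ h3 (Real.exp_pos _).le h1

lemma Phi_eq_integral (x : ℝ) : Phi x = ∫ t in Set.Iic x, phi t := by
  rw [Phi, cdf_eq_real, Measure.real, gaussianReal_apply_eq_integral _ one_ne_zero,
    ENNReal.toReal_ofReal]
  · rfl
  · exact integral_nonneg fun t => (phi_pos t).le

lemma Phi_sub (a b : ℝ) : Phi b - Phi a = ∫ t in a..b, phi t := by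
  rw [Phi_eq_integral, Phi_eq_integral,
    intervalIntegral.integral_Iic_sub_Iic integrable_phi.integrableOn integrable_phi.integrableOn]

lemma hasDerivAt_Phi (x : ℝ) : HasDerivAt Phi (phi x) x := by
  have h : Phi = fun y => Phi 0 + ∫ t in (0 : ℝ)..y, phi t := by
    ext y; rw [← Phi_sub]; ring
  rw [h]
  exact (continuous_phi.integral_hasStrictDerivAt 0 x).hasDerivAt.const_add _

lemma Phi_nonneg (x : ℝ) : 0 ≤ Phi x := cdf_nonneg _ _

lemma Phi_le_one (x : ℝ) : Phi x ≤ 1 := cdf_le_one _ _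

lemma Phi_mono : Monotone Phi := monotone_cdf _

lemma one_sub_Phi_eq_integral (x : ℝ) : 1 - Phi x = ∫ t in Set.Ioi x, phi t := by
  have h := integral_add_compl (measurableSet_Iic (a := x)) integrable_phi
  have h1 : ∫ t, phi t = 1 := integral_gaussianPDFReal_eq_one 0 one_ne_zero
  rw [Set.compl_Iic, h1, ← Phi_eq_integral] at h
  linarith

lemma Phi_neg (x : ℝ) : Phi (-x) = 1 - Phi x := by
  rw [one_sub_Phi_eq_integral, Phi_eq_integral, ← integral_comp_neg_Ioi]
  simp [phi_neg]

lemma continuous_Phi : Continuous Phi :=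
  continuous_iff_continuousAt.2 fun x => (hasDerivAt_Phi x).continuousAt

lemma tendsto_phi_atTop : Tendsto phi atTop (𝓝 0) := by
  have : phi = fun x => (√(2 * Real.pi))⁻¹ * Real.exp (-x ^ 2 / 2) := funext phi_eq
  rw [this, show (0 : ℝ) = (√(2 * Real.pi))⁻¹ * 0 by simp]
  refine Tendsto.const_mul _ (Real.tendsto_exp_atBot.comp ?_)
  have h : Tendsto (fun x : ℝ => x ^ 2 / 2) atTop atTop :=
    (tendsto_pow_atTop two_ne_zero).atTop_div_const two_pos
  refine (tendsto_neg_atTop_atBot.comp h).congr fun x => ?_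
  simp [neg_div]

/-- Mills' inequality: `x φ(x)` is the derivative of `-φ`, and `w ≤ x` on the tail. -/
lemma mul_one_sub_Phi_le {w : ℝ} (hw : 0 ≤ w) : w * (1 - Phi w) ≤ phi w := by
  have hd : ∀ x ∈ Set.Ici w, HasDerivAt (fun y => -phi y) (x * phi x) x := fun x _ =>
    (hasDerivAt_phi x).neg.congr_deriv (by ring)
  have hnn : ∀ x ∈ Set.Ioi w, 0 ≤ x * phi x := fun x hx =>
    mul_nonneg (hw.trans (le_of_lt hx)) (phi_pos x).le
  have ht : Tendsto (fun y => -phi y) atTop (𝓝 0) := by simpa using tendsto_phi_atTop.neg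
  have h1 := integral_Ioi_of_hasDerivAt_of_nonneg' hd hnn ht
  have h2 := integrableOn_Ioi_deriv_of_nonneg' hd hnn ht
  rw [one_sub_Phi_eq_integral, ← integral_const_mul]
  have h3 : ∫ x in Set.Ioi w, w * phi x ≤ ∫ x in Set.Ioi w, x * phi x := by
    refine setIntegral_mono_on (integrable_phi.const_mul w).integrableOn h2 measurableSet_Ioi
      fun x hx => ?_
    exact mul_le_mul_of_nonneg_right (le_of_lt hx) (phi_pos x).le
  rw [h1] at h3
  linarith

/-- For `w ≥ 1` this is Mills' inequality. On `[0, 1]` the density is at least `φ(1) ≥ 0.6 / 3 =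
1/5`, so the right side already exceeds one. -/
lemma one_sub_Phi_le {w : ℝ} (hw : 0 ≤ w) : 1 - Phi w ≤ 5 * phi w := by
  rcases le_total 1 w with h | h
  · have := mul_one_sub_Phi_le hw
    nlinarith [Phi_le_one w, phi_pos w]
  · have h1 : 1 ≤ 5 * phi w := by
      rw [phi_eq]
      have h2 : Real.exp (-1 / 2) ≤ Real.exp (-w ^ 2 / 2) := Real.exp_le_exp.2 (by nlinarith)
      have h3 : (0.6 : ℝ) ≤ Real.exp (-1 / 2) := by
        have h4 : Real.exp (-1 / 2) ^ 2 = (Real.exp 1)⁻¹ := by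
          rw [← Real.exp_nat_mul, ← Real.exp_neg]; norm_num
        have h5 : (0.36 : ℝ) ≤ (Real.exp 1)⁻¹ := by
          rw [le_inv_comm₀ (by norm_num) (Real.exp_pos _)]
          exact Real.exp_one_lt_d9.le.trans (by norm_num)
        nlinarith [Real.exp_pos (-1 / 2 : ℝ)]
      have h6 : √(2 * Real.pi) ≤ 3 := by
        rw [Real.sqrt_le_left (by norm_num)]
        nlinarith [Real.pi_lt_d2]
      have h7 : (3 : ℝ)⁻¹ ≤ (√(2 * Real.pi))⁻¹ := inv_anti₀ (by positivity) h6
      nlinarith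
    linarith [Phi_nonneg w]

lemma abs_Phi_sub_le (a b : ℝ) : |Phi a - Phi b| ≤ |a - b| := by
  have := convex_univ.norm_image_sub_le_of_norm_hasDerivWithin_le (f := Phi) (f' := phi) (C := 1)
    (fun x _ => (hasDerivAt_Phi x).hasDerivWithinAt)
    (fun x _ => by rw [Real.norm_eq_abs, abs_of_pos (phi_pos x)]; exact phi_le_one x)
    (Set.mem_univ b) (Set.mem_univ a)
  simpa using this

lemma abs_mul_phi_le (x : ℝ) : |x| * phi x ≤ 1 := by
  rw [phi_eq]
  have h1 : |x| ≤ Real.exp (x ^ 2 / 2) := by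
    have := Real.add_one_le_exp (x ^ 2 / 2)
    nlinarith [sq_nonneg (|x| - 1), sq_abs x]
  have h2 : 1 ≤ √(2 * Real.pi) := by
    rw [Real.one_le_sqrt]; nlinarith [Real.pi_gt_three]
  have h3 : (√(2 * Real.pi))⁻¹ ≤ 1 := inv_le_one_of_one_le₀ h2
  have h4 : |x| * Real.exp (-x ^ 2 / 2) ≤ 1 := by
    rw [neg_div, Real.exp_neg, ← div_eq_mul_inv]
    exact div_le_one_of_le₀ h1 (Real.exp_pos _).le
  calc |x| * ((√(2 * Real.pi))⁻¹ * Real.exp (-x ^ 2 / 2))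
      = (√(2 * Real.pi))⁻¹ * (|x| * Real.exp (-x ^ 2 / 2)) := by ring
    _ ≤ 1 := mul_le_one₀ h3 (by positivity) h4

/-- The derivative in `x` is `-φ(a/x) (a/x) / x`, and `|u| φ(u) ≤ 1` makes its bound independent of
`a`. This uniformity matters because `a` will contain the drift, which may be unbounded. -/
lemma abs_Phi_div_sub_le (a : ℝ) {c s t : ℝ} (hc : 0 < c) (hs : c ≤ s) (ht : c ≤ t) :
    |Phi (a / s) - Phi (a / t)| ≤ |s - t| / c := by
  have hd : ∀ x ∈ Set.Ici c, HasDerivWithinAt (fun x => Phi (a / x))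
      (phi (a / x) * (-(a / x) / x)) (Set.Ici c) x := fun x hx => by
    have hx0 : x ≠ 0 := (hc.trans_le hx).ne'
    have h1 : HasDerivAt (fun x => a / x) (-(a / x) / x) x := by
      have := (hasDerivAt_inv hx0).const_mul a
      refine (this.congr_deriv ?_).congr_of_eventuallyEq (.of_forall fun y => div_eq_mul_inv _ _)
      field_simp
    exact ((hasDerivAt_Phi _).comp x h1).hasDerivWithinAt
  have hb : ∀ x ∈ Set.Ici c, ‖phi (a / x) * (-(a / x) / x)‖ ≤ c⁻¹ := fun x hx => by
    have hx0 : 0 < x := hc.trans_le hx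
    rw [norm_mul, norm_div, norm_neg, Real.norm_eq_abs, Real.norm_eq_abs, Real.norm_eq_abs,
      abs_of_pos (phi_pos _), abs_of_pos hx0]
    calc phi (a / x) * (|a / x| / x) = (|a / x| * phi (a / x)) * x⁻¹ := by ring
      _ ≤ 1 * c⁻¹ := mul_le_mul (abs_mul_phi_le _) (inv_anti₀ hc hx) (by positivity) one_pos.le
      _ = c⁻¹ := one_mul _
  have := (convex_Ici c).norm_image_sub_le_of_norm_hasDerivWithin_le hd hb ht hs
  rw [Real.norm_eq_abs, Real.norm_eq_abs] at this
  exact this.trans_eq (div_eq_inv_mul _ _).symm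

/-! ### The Stein equation -/

/-- The solution of the Stein equation `g' w = w g w + 1_{w ≤ z} - Φ z`. -/
noncomputable def steinSol (z w : ℝ) : ℝ :=
  if w ≤ z then (1 - Phi z) * (Phi w / phi w) else Phi z * ((1 - Phi w) / phi w)

lemma hasDerivAt_Phi_div_phi (w : ℝ) :
    HasDerivAt (fun w => Phi w / phi w) (1 + w * (Phi w / phi w)) w := by
  refine ((hasDerivAt_Phi w).div (hasDerivAt_phi w) (phi_pos w).ne').congr_deriv ?_
  field_simp [(phi_pos w).ne']
  ring

lemma hasDerivAt_one_sub_Phi_div_phi (w : ℝ) :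
    HasDerivAt (fun w => (1 - Phi w) / phi w) (-1 + w * ((1 - Phi w) / phi w)) w := by
  refine (((hasDerivAt_Phi w).const_sub 1).div (hasDerivAt_phi w) (phi_pos w).ne').congr_deriv ?_
  field_simp [(phi_pos w).ne']
  ring

lemma continuous_steinSol (z : ℝ) : Continuous (steinSol z) := by
  refine Continuous.if_le ?_ ?_ continuous_id continuous_const ?_
  · exact (continuous_Phi.div continuous_phi fun w => (phi_pos w).ne').const_mul _
  · exact ((continuous_const.sub continuous_Phi).div continuous_phi
      fun w => (phi_pos w).ne').const_mul _
  · rintro w rfl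
    ring

lemma hasDerivAt_steinSol {z w : ℝ} (h : w ≠ z) :
    HasDerivAt (steinSol z) (w * steinSol z w + (if w ≤ z then 1 else 0) - Phi z) w := by
  rcases h.lt_or_gt with h | h
  · have h1 := (hasDerivAt_Phi_div_phi w).const_mul (1 - Phi z)
    refine (h1.congr_deriv ?_).congr_of_eventuallyEq ?_
    · simp only [steinSol, h.le, if_true]; ring
    · filter_upwards [Iio_mem_nhds h] with v hv
      simp [steinSol, le_of_lt (Set.mem_Iio.1 hv)]
  · have h1 := (hasDerivAt_one_sub_Phi_div_phi w).const_mul (Phi z)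
    refine (h1.congr_deriv ?_).congr_of_eventuallyEq ?_
    · simp only [steinSol, not_le.2 h, if_false]; ring
    · filter_upwards [Ioi_mem_nhds h] with v hv
      simp [steinSol, not_le.2 (Set.mem_Ioi.1 hv)]

lemma steinSol_nonneg (z w : ℝ) : 0 ≤ steinSol z w := by
  have := Phi_nonneg z
  have := Phi_nonneg w
  have := Phi_le_one z
  have := Phi_le_one w
  have := phi_pos w
  rw [steinSol]
  split_ifs
  · exact mul_nonneg (by linarith) (by positivity)
  · exact mul_nonneg (by linarith) (div_nonneg (by linarith) this.le)

/-- On either branch, monotonicity of `Φ` bounds the product by both `Φ w` and `1 - Φ w`; symmetry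
selects the tail at `|w|`. With the tail bounds for `1 - Φ`, this controls both the solution and `w`
times the solution. -/
lemma steinSol_mul_phi_le (z w : ℝ) : steinSol z w * phi w ≤ 1 - Phi |w| := by
  have h1 := Phi_nonneg z
  have h2 := Phi_nonneg w
  have h3 := Phi_le_one z
  have h4 := Phi_le_one w
  have h5 := phi_pos w
  have key : steinSol z w * phi w ≤ min (Phi w) (1 - Phi w) := by
    rw [steinSol]
    split_ifs with h
    · rw [mul_assoc, div_mul_cancel₀ _ h5.ne']
      have := Phi_mono h
      refine le_min ?_ ?_ <;> nlinarith
    · rw [mul_assoc, div_mul_cancel₀ _ h5.ne']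
      have := Phi_mono (le_of_not_ge h)
      refine le_min ?_ ?_ <;> nlinarith
  rcases le_total 0 w with h | h
  · rw [abs_of_nonneg h]; exact key.trans (min_le_right _ _)
  · rw [abs_of_nonpos h, Phi_neg, sub_sub_cancel]; exact key.trans (min_le_left _ _)

lemma phi_abs (w : ℝ) : phi |w| = phi w := by
  rcases abs_choice w with h | h <;> rw [h]
  exact phi_neg w

lemma steinSol_le (z w : ℝ) : steinSol z w ≤ 5 := by
  have h := (steinSol_mul_phi_le z w).trans (one_sub_Phi_le (abs_nonneg w))
  rw [phi_abs] at h
  exact le_of_mul_le_mul_right h (phi_pos w)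

lemma abs_mul_steinSol_le (z w : ℝ) : |w * steinSol z w| ≤ 1 := by
  have h := mul_one_sub_Phi_le (abs_nonneg w)
  rw [phi_abs] at h
  have h2 := mul_le_mul_of_nonneg_left (steinSol_mul_phi_le z w) (abs_nonneg w)
  rw [abs_mul, abs_of_nonneg (steinSol_nonneg z w)]
  refine le_of_mul_le_mul_right (a := phi w) ?_ (phi_pos w)
  linarith

/-- A mean value inequality for functions differentiable off one point. -/
lemma mul_sub_le_sub_of_hasDerivAt_off_point {g g' : ℝ → ℝ} {z m a b : ℝ} (hg : Continuous g)
    (hd : ∀ w, w ≠ z → HasDerivAt g (g' w) w)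
    (hm : ∀ w ∈ Set.Icc a b, m ≤ g' w) (hab : a ≤ b) : m * (b - a) ≤ g b - g a := by
  have key : ∀ c d, a ≤ c → c ≤ d → d ≤ b → (∀ w ∈ Set.Ioo c d, w ≠ z) →
      m * (d - c) ≤ g d - g c := by
    intro c d hc hcd hd' hz
    refine (convex_Icc c d).mul_sub_le_image_sub_of_le_deriv hg.continuousOn ?_ ?_ c
      (Set.left_mem_Icc.2 hcd) d (Set.right_mem_Icc.2 hcd) hcd
    · rw [interior_Icc]
      exact fun w hw => (hd w (hz w hw)).differentiableAt.differentiableWithinAt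
    · rw [interior_Icc]
      intro w hw
      rw [(hd w (hz w hw)).deriv]
      exact hm w ⟨hc.trans hw.1.le, hw.2.le.trans hd'⟩
  by_cases h : z ∈ Set.Icc a b
  · have h1 := key a z le_rfl h.1 h.2 fun w hw => hw.2.ne
    have h2 := key z b h.1 h.2 le_rfl fun w hw => hw.1.ne'
    linarith
  · exact key a b le_rfl hab le_rfl fun w hw e => h (e ▸ Set.Ioo_subset_Icc_self hw)

lemma abs_steinSol_deriv_le (z w : ℝ) :
    |w * steinSol z w + (if w ≤ z then 1 else 0) - Phi z| ≤ 2 := by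
  have h1 := abs_le.1 (abs_mul_steinSol_le z w)
  have h2 := Phi_nonneg z
  have h3 := Phi_le_one z
  rw [abs_le]
  split_ifs <;> constructor <;> linarith [h1.1, h1.2]

lemma abs_steinSol_sub_le (z a b : ℝ) : |steinSol z a - steinSol z b| ≤ 2 * |a - b| := by
  wlog h : a ≤ b generalizing a b
  · rw [abs_sub_comm, abs_sub_comm a]; exact this b a (le_of_not_ge h)
  have h1 := mul_sub_le_sub_of_hasDerivAt_off_point (a := a) (b := b) (m := -2)
    (continuous_steinSol z) (fun w hw => hasDerivAt_steinSol hw)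
    (fun w _ => (abs_le.1 (abs_steinSol_deriv_le z w)).1) h
  have h2 := mul_sub_le_sub_of_hasDerivAt_off_point (a := a) (b := b) (m := -2)
    (continuous_steinSol z).neg (fun w hw => (hasDerivAt_steinSol hw).neg)
    (fun w _ => neg_le_neg (abs_le.1 (abs_steinSol_deriv_le z w)).2) h
  simp only [Pi.neg_apply] at h2
  rw [abs_sub_comm, abs_sub_comm a, abs_of_nonneg (sub_nonneg.2 h), abs_le]
  constructor <;> linarith

lemma abs_mul_steinSol_sub_le (z a b : ℝ) :
    |a * steinSol z a - b * steinSol z b| ≤ |a - b| * (5 + 2 * |b|) := by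
  have h1 : |steinSol z a| ≤ 5 := by
    rw [abs_of_nonneg (steinSol_nonneg z a)]; exact steinSol_le z a
  calc |a * steinSol z a - b * steinSol z b|
      = |(a - b) * steinSol z a + b * (steinSol z a - steinSol z b)| := by ring_nf
    _ ≤ |a - b| * |steinSol z a| + |b| * |steinSol z a - steinSol z b| := by
        rw [← abs_mul, ← abs_mul]; exact abs_add_le _ _
    _ ≤ |a - b| * 5 + |b| * (2 * |a - b|) := by
        gcongr; exact abs_steinSol_sub_le z a b
    _ = |a - b| * (5 + 2 * |b|) := by ring

/-- The derivative of the Stein solution near `w` bounds its increments from below. -/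
lemma sq_mul_le_mul_steinSol_sub {d s x x' z : ℝ} (hx : |x| ≤ d) (hx' : |x'| ≤ d) :
    x' ^ 2 * ((x + s) * steinSol z (x + s) - 2 * d * (5 + 2 * |x + s|) +
      (if x + s ≤ z - 2 * d then 1 else 0) - Phi z) ≤
      x' * (steinSol z (x' + s) - steinSol z s) := by
  set m := (x + s) * steinSol z (x + s) - 2 * d * (5 + 2 * |x + s|) +
      (if x + s ≤ z - 2 * d then 1 else 0) - Phi z with hm
  have hx1 := abs_le.1 hx
  have hx2 := abs_le.1 hx'
  -- Both `w` and `x + s` lie within `d` of `s`, hence within `2 d` of each other. The indicator is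
  -- cut at `z - 2 * d` so that `x + s` below the cut forces `w ≤ z`.
  have key : ∀ w, |w - s| ≤ d → m ≤ w * steinSol z w + (if w ≤ z then 1 else 0) - Phi z := by
    intro w hw
    have hw1 := abs_le.1 hw
    have h1 : |w - (x + s)| ≤ 2 * d := by
      rw [abs_le]; constructor <;> linarith [hw1.1, hw1.2, hx1.1, hx1.2]
    have h2 := (abs_le.1 (abs_mul_steinSol_sub_le z w (x + s))).1
    have h3 : |w - (x + s)| * (5 + 2 * |x + s|) ≤ 2 * d * (5 + 2 * |x + s|) :=
      mul_le_mul_of_nonneg_right h1 (by positivity)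
    have h4 : (if x + s ≤ z - 2 * d then (1 : ℝ) else 0) ≤ if w ≤ z then 1 else 0 := by
      have := abs_le.1 h1
      split_ifs with h5 h6 <;> linarith
    rw [hm]; linarith
  rcases le_total 0 x' with h | h
  · have := mul_sub_le_sub_of_hasDerivAt_off_point (a := s) (b := x' + s) (m := m)
      (continuous_steinSol z) (fun w hw => hasDerivAt_steinSol hw)
      (fun w hw => key w (abs_le.2 ⟨by linarith [hw.1], by linarith [hw.2, hx2.2]⟩)) (by linarith)
    have := mul_le_mul_of_nonneg_left this h
    linarith
  · have := mul_sub_le_sub_of_hasDerivAt_off_point (a := x' + s) (b := s) (m := m)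
      (continuous_steinSol z) (fun w hw => hasDerivAt_steinSol hw)
      (fun w hw => key w (abs_le.2 ⟨by linarith [hw.1, hx2.1], by linarith [hw.2]⟩)) (by linarith)
    have := mul_le_mul_of_nonneg_left this (neg_nonneg.2 h)
    linarith

/-! ### A Berry–Esseen bound for bounded i.i.d. summands -/

section BerryEsseen

lemma abs_sum_comp_le {α : Type*} {g : α → ℝ} {d : ℝ} (hd : ∀ a, |g a| ≤ d) {n : ℕ} (j : Fin n → α) :
    |∑ i, g (j i)| ≤ n * d :=
  (Finset.abs_sum_le_sum_abs _ _).trans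
    ((Finset.sum_le_sum fun i _ => hd (j i)).trans (by simp))

variable {α : Type*} [MeasurableSpace α] {μ : Measure α} [IsProbabilityMeasure μ] {g : α → ℝ}
  {d : ℝ}

lemma measurable_sum_comp (hg : Measurable g) (n : ℕ) :
    Measurable fun j : Fin n → α => ∑ i, g (j i) :=
  Finset.measurable_sum _ fun i _ => hg.comp (measurable_pi_apply i)

lemma integrable_comp_of_continuous {β : Type*} [MeasurableSpace β] {ν : Measure β}
    [IsFiniteMeasure ν] {W : β → ℝ} {c : ℝ} (hW : Measurable W) (hc : ∀ x, |W x| ≤ c) {F : ℝ → ℝ}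
    (hF : Continuous F) : Integrable (fun x => F (W x)) ν := by
  obtain ⟨C, hC⟩ := (isCompact_Icc (a := -c) (b := c)).exists_bound_of_continuousOn hF.continuousOn
  exact Integrable.of_bound (hF.measurable.comp hW).aestronglyMeasurable C
    (.of_forall fun x => hC _ (abs_le.1 (hc x)))

/-- Splitting one coordinate off an i.i.d. sequence. -/
lemma integral_pi_split {n : ℕ} (i : Fin (n + 1)) (H : α × (Fin n → α) → ℝ) :
    ∫ j, H (j i, fun k => j (i.succAbove k)) ∂(Measure.pi fun _ : Fin (n + 1) => μ) =
      ∫ p, H p ∂(μ.prod (Measure.pi fun _ : Fin n => μ)) :=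
  (measurePreserving_piFinSuccAbove (fun _ : Fin (n + 1) => μ) i).integral_comp' H

/-- By exchangeability all `n + 1` coordinates contribute equally, and the one split off is
independent of the sum of the others. -/
lemma integral_sum_mul_comp_sum (hg : Measurable g) (hd : ∀ a, |g a| ≤ d) {F : ℝ → ℝ}
    (hF : Continuous F) (n : ℕ) :
    ∫ j, (∑ i, g (j i)) * F (∑ i, g (j i)) ∂(Measure.pi fun _ : Fin (n + 1) => μ) =
      (n + 1) * ∫ r, (∫ a, g a * F (g a + ∑ i, g (r i)) ∂μ)
        ∂(Measure.pi fun _ : Fin n => μ) := by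
  have hFi : ∀ i, Integrable (fun j : Fin (n + 1) → α => g (j i) * F (∑ i, g (j i)))
      (Measure.pi fun _ : Fin (n + 1) => μ) := fun i =>
    (integrable_comp_of_continuous (measurable_sum_comp hg _) (abs_sum_comp_le hd) hF).bdd_mul
      (c := d) (hg.comp (measurable_pi_apply i)).aestronglyMeasurable
      (.of_forall fun j => hd (j i))
  have hms : Measurable fun p : α × (Fin n → α) => g p.1 + ∑ i, g (p.2 i) :=
    (hg.comp measurable_fst).add ((measurable_sum_comp hg n).comp measurable_snd)
  have hbs : ∀ p : α × (Fin n → α), |g p.1 + ∑ i, g (p.2 i)| ≤ d + n * d := fun p =>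
    (abs_add_le _ _).trans (add_le_add (hd _) (abs_sum_comp_le hd _))
  have hint : Integrable (fun p : α × (Fin n → α) => g p.1 * F (g p.1 + ∑ i, g (p.2 i)))
      (μ.prod (Measure.pi fun _ : Fin n => μ)) :=
    (integrable_comp_of_continuous hms hbs hF).bdd_mul (c := d)
      (hg.comp measurable_fst).aestronglyMeasurable (.of_forall fun p => hd p.1)
  simp_rw [Finset.sum_mul]
  rw [integral_finsetSum _ fun i _ => hFi i, ← integral_prod_symm _ hint]
  have : ∀ i : Fin (n + 1),
      ∫ j, g (j i) * F (∑ i, g (j i)) ∂(Measure.pi fun _ : Fin (n + 1) => μ) =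
        ∫ p : α × (Fin n → α), g p.1 * F (g p.1 + ∑ i, g (p.2 i))
          ∂(μ.prod (Measure.pi fun _ : Fin n => μ)) := fun i => by
    rw [← integral_pi_split i]
    simp_rw [Fin.sum_univ_succAbove _ i]
  simp [this]

/-- One half of the Berry–Esseen bound. -/
lemma measureReal_sum_le_le (hg : Measurable g) (hd : ∀ a, |g a| ≤ d)
    (h0 : ∫ a, g a ∂μ = 0) {n : ℕ} (h1 : (n + 1) * ∫ a, g a ^ 2 ∂μ = 1) (y : ℝ) :
    (Measure.pi fun _ : Fin (n + 1) => μ).real {j | ∑ i, g (j i) ≤ y} ≤ Phi y + 16 * d := by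
  -- The Stein equation is solved at a shifted threshold, so that the cut `z - 2 * d` is exactly
  -- `y`.
  set z := y + 2 * d with hz
  set π := Measure.pi fun _ : Fin (n + 1) => μ with hπ
  set W : (Fin (n + 1) → α) → ℝ := fun j => ∑ i, g (j i) with hW
  have hd0 : 0 ≤ d := by
    obtain ⟨a⟩ := μ.nonempty_of_neZero
    exact (abs_nonneg _).trans (hd a)
  have hWm : Measurable W := measurable_sum_comp hg _
  have hWb : ∀ j, |W j| ≤ (n + 1 : ℕ) * d := abs_sum_comp_le hd
  set f := steinSol z with hf
  have hfc : Continuous f := continuous_steinSol z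
  have hgi : ∀ F : ℝ → ℝ, Continuous F → Integrable (fun a => F (g a)) μ := fun F hF =>
    integrable_comp_of_continuous hg hd hF
  have gi1 : Integrable (fun a => g a) μ := hgi id continuous_id
  have hWi : ∀ F : ℝ → ℝ, Continuous F → Integrable (fun a => F (W a)) π := fun F hF =>
    integrable_comp_of_continuous hWm hWb hF
  have hset : MeasurableSet {j | W j ≤ y} := measurableSet_le hWm measurable_const
  -- the second moment of the sum
  have hW2 : ∫ j, W j * W j ∂π = 1 := by
    have := integral_sum_mul_comp_sum (μ := μ) hg hd (F := id) continuous_id n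
    simp only [id] at this
    rw [hW, this]
    have h2 : ∀ r : Fin n → α, ∫ a, g a * (g a + ∑ i, g (r i)) ∂μ = ∫ a, g a ^ 2 ∂μ := fun r => by
      have : ∀ a, g a * (g a + ∑ i, g (r i)) = g a ^ 2 + g a * ∑ i, g (r i) := fun a => by ring
      simp_rw [this]
      rw [integral_add (hgi (fun x => x ^ 2) (by fun_prop)) (gi1.mul_const _),
        integral_mul_const, h0]
      simp
    simpa only [h2, integral_const, probReal_univ, one_smul] using h1
  have hW1 : ∫ j, |W j| ∂π ≤ 1 := by
    have : ∫ j, |W j| ∂π ≤ ∫ j, (1 + W j * W j) / 2 ∂π := by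
      refine integral_mono (hWi (fun x => |x|) continuous_abs)
        (hWi (fun x => (1 + x * x) / 2) (by fun_prop)) fun j => ?_
      nlinarith [sq_nonneg (|W j| - 1), abs_mul_abs_self (W j)]
    rw [integral_div, integral_add (integrable_const _) (hWi (fun x => x * x) (by fun_prop)),
      hW2] at this
    simpa using this
  -- the lower bound for the Stein expectation
  set L : ℝ → ℝ := fun w => w * f w - 2 * d * (5 + 2 * |w|) +
    (if w ≤ z - 2 * d then 1 else 0) - Phi z with hL
  have hL1 : Continuous fun w => w * f w - 2 * d * (5 + 2 * |w|) := by fun_prop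
  have hLint : ∀ {β : Type _} [MeasurableSpace β] {ν : Measure β} [IsFiniteMeasure ν] {V : β → ℝ}
      {c : ℝ}, Measurable V → (∀ x, |V x| ≤ c) → Integrable (fun x => L (V x)) ν := by
    intro β _ ν _ V c hV hc
    refine ((integrable_comp_of_continuous hV hc hL1).add ?_).sub (integrable_const _)
    refine Integrable.of_bound (C := 1) ?_ (.of_forall fun x => ?_)
    · exact (Measurable.ite (hV measurableSet_Iic) measurable_const
        measurable_const).aestronglyMeasurable
    · split_ifs <;> simp
  -- Centring allows `f s` to be subtracted for free. The point `x` plays an independent copy of the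
  -- split-off coordinate: the lower bound for the derivative depends on `x` but not on `a`, so the
  -- factor `g a ^ 2` integrates separately. Averaging over `x` and `r` then gives `g x + s` the law
  -- of `W`.
  have hLle : ∀ (x : α) (r : Fin n → α), (∫ a, g a ^ 2 ∂μ) * L (g x + ∑ i, g (r i)) ≤
      ∫ a, g a * f (g a + ∑ i, g (r i)) ∂μ := by
    intro x r
    set s := ∑ i, g (r i)
    have i1 : Integrable (fun a => g a * f (g a + s)) μ :=
      hgi (fun x => x * f (x + s)) (by fun_prop)
    have i2 : Integrable (fun a => g a * f s) μ := gi1.mul_const _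
    have : ∫ a, g a * f (g a + s) ∂μ = ∫ a, g a * (f (g a + s) - f s) ∂μ := by
      simp_rw [mul_sub]
      rw [integral_sub i1 i2, integral_mul_const, h0]; simp
    rw [this, ← integral_mul_const]
    refine integral_mono ((hgi (fun x => x ^ 2) (by fun_prop)).mul_const _)
      (hgi (fun x => x * (f (x + s) - f s)) (by fun_prop)) fun a => ?_
    exact sq_mul_le_mul_steinSol_sub (hd x) (hd a)
  have hms : Measurable fun p : α × (Fin n → α) => g p.1 + ∑ i, g (p.2 i) :=
    (hg.comp measurable_fst).add ((measurable_sum_comp hg n).comp measurable_snd)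
  have hbs : ∀ p : α × (Fin n → α), |g p.1 + ∑ i, g (p.2 i)| ≤ d + n * d := fun p =>
    (abs_add_le _ _).trans (add_le_add (hd _) (abs_sum_comp_le hd _))
  have hmain : ∫ j, L (W j) ∂π ≤ ∫ j, W j * f (W j) ∂π := by
    rw [hW, integral_sum_mul_comp_sum (μ := μ) hg hd hfc n]
    have e1 : ∫ j, L (∑ i, g (j i)) ∂π = ∫ p : α × (Fin n → α), L (g p.1 + ∑ i, g (p.2 i))
        ∂(μ.prod (Measure.pi fun _ : Fin n => μ)) := by
      rw [← integral_pi_split 0]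
      simp_rw [Fin.sum_univ_succAbove _ 0]
      rfl
    have i3 := hLint (ν := μ.prod (Measure.pi fun _ : Fin n => μ)) hms hbs
    rw [e1, integral_prod_symm _ i3, ← integral_const_mul]
    have hn : (0 : ℝ) < n + 1 := by positivity
    have i4 : Integrable (fun p : α × (Fin n → α) => g p.1 * f (g p.1 + ∑ i, g (p.2 i)))
        (μ.prod (Measure.pi fun _ : Fin n => μ)) :=
      (integrable_comp_of_continuous hms hbs hfc).bdd_mul (c := d)
        (hg.comp measurable_fst).aestronglyMeasurable (.of_forall fun p => hd p.1)
    refine integral_mono i3.integral_prod_right (i4.integral_prod_right.const_mul _) fun r => ?_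
    have i5 : Integrable (fun x => L (g x + ∑ i, g (r i))) μ :=
      hLint (c := d + n * d) (hg.add_const _) fun x =>
        (abs_add_le _ _).trans (add_le_add (hd _) (abs_sum_comp_le hd _))
    have := integral_mono (μ := μ) (i5.const_mul _) (integrable_const _) fun x => hLle x r
    rw [integral_const_mul] at this
    simp only [integral_const, probReal_univ, one_smul] at this
    have h2 := mul_le_mul_of_nonneg_left this hn.le
    rwa [← mul_assoc, h1, one_mul] at h2
  have hexp : ∫ j, L (W j) ∂π = ∫ j, W j * f (W j) ∂π - 2 * d * (5 + 2 * ∫ j, |W j| ∂π) +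
      π.real {j | W j ≤ y} - Phi z := by
    have j1 : Integrable (fun j => W j * f (W j)) π := hWi (fun x => x * f x) (by fun_prop)
    have j2 : Integrable (fun j => |W j|) π := hWi (fun x => |x|) continuous_abs
    have j3 : Integrable (fun j => 2 * d * (5 + 2 * |W j|)) π :=
      hWi (fun x => 2 * d * (5 + 2 * |x|)) (by fun_prop)
    have e2 : ∀ j, L (W j) = W j * f (W j) - 2 * d * (5 + 2 * |W j|) +
        ({j | W j ≤ y}.indicator (fun _ => (1 : ℝ)) j) - Phi z := fun j => by
      simp [hL, hz, Set.indicator_apply]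
    have j4 : Integrable (fun j => {j | W j ≤ y}.indicator (fun _ => (1 : ℝ)) j) π :=
      (integrable_const _).indicator hset
    have j5 : Integrable (fun j => W j * f (W j) - 2 * d * (5 + 2 * |W j|)) π := j1.sub j3
    have j6 : Integrable (fun j => W j * f (W j) - 2 * d * (5 + 2 * |W j|) +
        {j | W j ≤ y}.indicator (fun _ => (1 : ℝ)) j) π := j5.add j4
    simp_rw [e2]
    rw [integral_sub j6 (integrable_const _), integral_add j5 j4,
      integral_sub j1 j3, integral_const_mul, integral_add (integrable_const _) (j2.const_mul _),
      integral_const_mul, integral_indicator_const _ hset]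
    simp
  -- The terms `W * f W` cancel between `hmain` and `hexp`. What is left is `2 d (5 + 2 E|W|) ≤ 14
  -- d`, plus `2 d` for moving the threshold from `z` back to `y`.
  have hPhi := (abs_le.1 (abs_Phi_sub_le z y)).2
  have : |z - y| = 2 * d := by rw [hz, add_sub_cancel_left, abs_of_nonneg (by linarith)]
  have hfin : d * ∫ j, |W j| ∂π ≤ d * 1 := mul_le_mul_of_nonneg_left hW1 hd0
  linarith

/-- The **Berry–Esseen bound** for bounded centred i.i.d. summands with total variance `1`. -/
theorem abs_measureReal_sum_le_sub_Phi_le (hg : Measurable g) (hd : ∀ a, |g a| ≤ d)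
    (h0 : ∫ a, g a ∂μ = 0) {n : ℕ} (hn : 1 ≤ n) (h1 : n * ∫ a, g a ^ 2 ∂μ = 1) (y : ℝ) :
    |(Measure.pi fun _ : Fin n => μ).real {j | ∑ i, g (j i) ≤ y} - Phi y| ≤ 16 * d := by
  obtain ⟨n, rfl⟩ := Nat.exists_eq_add_of_le' hn
  push_cast at h1
  have up := measureReal_sum_le_le hg hd h0 h1 y
  -- The reverse bound is the same half applied to `-g` at `-y`, because the event that the sum
  -- exceeds `y` lies in the event that its negative is at most `-y`.
  have lo := measureReal_sum_le_le (μ := μ) (g := fun a => -g a) hg.neg (fun a => by simpa using hd a)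
    (by simp [integral_neg, h0]) (n := n) (by simpa using h1) (-y)
  rw [Phi_neg] at lo
  have hWm := measurable_sum_comp hg (n + 1)
  have hset : MeasurableSet {j : Fin (n + 1) → α | ∑ i, g (j i) ≤ y} :=
    measurableSet_le hWm measurable_const
  have hc := probReal_compl_eq_one_sub (μ := Measure.pi fun _ : Fin (n + 1) => μ) hset
  have hmono : (Measure.pi fun _ : Fin (n + 1) => μ).real {j | ∑ i, g (j i) ≤ y}ᶜ ≤
      (Measure.pi fun _ : Fin (n + 1) => μ).real {j | ∑ i, -g (j i) ≤ -y} := by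
    refine measureReal_mono fun j hj => ?_
    simp only [Set.mem_compl_iff, Set.mem_ofPred_eq, not_le, Finset.sum_neg_distrib] at hj ⊢
    linarith
  rw [abs_le]
  constructor <;> linarith

end BerryEsseen

/-! ### Mean and variance of kernel averages -/

/-- The expectation `∫ ψ(u) f(x₀ + h u) du` of the kernel average with kernel `ψ`. -/
noncomputable def kernelMean (ψ f : ℝ → ℝ) (x₀ h : ℝ) : ℝ := ∫ u, ψ u * f (x₀ + h * u)

/-- A non-integrable function has Bochner integral `0` by convention, which contradicts `∫ K = 1`.
-/
lemma IsKernel.integrable {K : ℝ → ℝ} (hK : IsKernel K) : Integrable K := by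
  by_contra h
  have := hK.integral_eq_one
  rw [integral_undef h] at this
  exact zero_ne_one this

lemma integrable_mul_comp_affine {ψ f : ℝ → ℝ} {M : ℝ} (hψ : Integrable ψ) (hf : Measurable f)
    (hM : ∀ x, |f x| ≤ M) (x₀ h : ℝ) : Integrable fun u => ψ u * f (x₀ + h * u) :=
  hψ.mul_bdd (c := M) (hf.comp (by fun_prop)).aestronglyMeasurable (.of_forall fun u => hM _)

lemma abs_kernelMean_le {ψ f : ℝ → ℝ} {M : ℝ} (hψ : Integrable ψ) (hψ0 : ∀ u, 0 ≤ ψ u)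
    (hf : Measurable f) (hM : ∀ x, |f x| ≤ M) (x₀ h : ℝ) :
    |kernelMean ψ f x₀ h| ≤ M * ∫ u, ψ u := by
  rw [kernelMean, ← integral_const_mul]
  refine (abs_integral_le_integral_abs).trans (integral_mono
    (integrable_mul_comp_affine hψ hf hM x₀ h).abs (hψ.const_mul M) fun u => ?_)
  dsimp only
  rw [abs_mul, abs_of_nonneg (hψ0 u), mul_comm]
  exact mul_le_mul_of_nonneg_right (hM _) (hψ0 u)

/-- As the bandwidth tends to zero, the kernel mean tends to `f x₀ ∫ ψ`. -/
lemma tendsto_kernelMean {ψ f : ℝ → ℝ} {M x₀ : ℝ} (hψ : Integrable ψ)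
    (hf : Measurable f) (hM : ∀ x, |f x| ≤ M) (hc : ContinuousAt f x₀) {h : ℕ → ℝ}
    (hh : Tendsto h atTop (𝓝 0)) :
    Tendsto (fun n => kernelMean ψ f x₀ (h n)) atTop (𝓝 (f x₀ * ∫ u, ψ u)) := by
  rw [← integral_const_mul]
  refine tendsto_integral_of_dominated_convergence (fun u => ‖ψ u‖ * M)
    (fun n => (integrable_mul_comp_affine hψ hf hM x₀ (h n)).aestronglyMeasurable)
    (hψ.norm.mul_const M) (fun n => .of_forall fun u => ?_) (.of_forall fun u => ?_)
  · rw [norm_mul]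
    exact mul_le_mul_of_nonneg_left (hM _) (norm_nonneg _)
  · rw [mul_comm (f x₀)]
    refine Tendsto.const_mul _ (hc.tendsto.comp ?_)
    simpa using (hh.mul_const u).const_add x₀

section KernelAverages

variable {Ω : Type*} [MeasurableSpace Ω] {P : Measure Ω} {X : ℕ → Ω → ℝ} {f ψ : ℝ → ℝ}
  {x₀ M B : ℝ}

lemma integral_comp_rescale {Y : Ω → ℝ} (hY : Measurable Y) (hf : Measurable f)
    (hf0 : ∀ x, 0 ≤ f x)
    (hlaw : P.map Y = volume.withDensity fun x => ENNReal.ofReal (f x)) (hψ : Measurable ψ)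
    (x₀ : ℝ) {h : ℝ} (hh : 0 < h) :
    ∫ ω, ψ ((Y ω - x₀) / h) ∂P = h * kernelMean ψ f x₀ h := by
  have hm : Measurable fun y => ψ ((y - x₀) / h) := hψ.comp (by fun_prop)
  rw [← integral_map (f := fun y => ψ ((y - x₀) / h)) hY.aemeasurable hm.aestronglyMeasurable, hlaw,
    integral_withDensity_eq_integral_toReal_smul (by fun_prop) (by simp), kernelMean]
  have e : ∀ u, ψ u * f (x₀ + h * u) =
      (fun x => (ENNReal.ofReal (f (x₀ + x))).toReal • ψ ((x₀ + x - x₀) / h)) (h * u) := fun u => by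
    simp only [ENNReal.toReal_ofReal (hf0 _), add_sub_cancel_left, smul_eq_mul]
    rw [mul_div_cancel_left₀ _ hh.ne', mul_comm]
  simp_rw [e]
  rw [Measure.integral_comp_mul_left
    (fun x => (ENNReal.ofReal (f (x₀ + x))).toReal • ψ ((x₀ + x - x₀) / h)) h,
    integral_add_left_eq_self (fun x => (ENNReal.ofReal (f x)).toReal • ψ ((x - x₀) / h)) x₀,
    abs_of_pos (inv_pos.2 hh), smul_eq_mul, mul_inv_cancel_left₀ hh.ne']

variable [IsProbabilityMeasure P]

lemma memLp_comp_rescale {Y : Ω → ℝ} (hY : Measurable Y) (hψ : Measurable ψ)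
    (hB : ∀ u, |ψ u| ≤ B) (x₀ h : ℝ) : MemLp (fun ω => ψ ((Y ω - x₀) / h)) 2 P :=
  MemLp.of_bound (hψ.comp (by fun_prop)).aestronglyMeasurable B (.of_forall fun ω => hB _)

lemma memLp_kde (hX : ∀ i, Measurable (X i)) (hψ : Measurable ψ) (hB : ∀ u, |ψ u| ≤ B) (n : ℕ)
    (h : ℝ) : MemLp (kde ψ x₀ X n h) 2 P :=
  (memLp_finsetSum _ fun i _ => memLp_comp_rescale (hX i) hψ hB x₀ h).const_mul _

lemma integral_kde (hX : ∀ i, Measurable (X i)) (hf : Measurable f) (hf0 : ∀ x, 0 ≤ f x)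
    (hlaw : ∀ i, P.map (X i) = volume.withDensity fun x => ENNReal.ofReal (f x))
    (hψ : Measurable ψ) (hB : ∀ u, |ψ u| ≤ B) {n : ℕ} (hn : 1 ≤ n) {h : ℝ} (hh : 0 < h) :
    ∫ ω, kde ψ x₀ X n h ω ∂P = kernelMean ψ f x₀ h := by
  have hn' : (n : ℝ) ≠ 0 := by positivity
  simp only [kde]
  rw [integral_const_mul, integral_finsetSum _ fun i _ =>
    (memLp_comp_rescale (hX i) hψ hB x₀ h).integrable (by norm_num)]
  simp only [integral_comp_rescale (hX _) hf hf0 (hlaw _) hψ x₀ hh, Finset.sum_const,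
    Nat.card_Icc, nsmul_eq_mul, Nat.add_sub_cancel]
  field_simp

/-- With `ψ = K` this makes `σ_h²` an exact function of two kernel means, of the same shape as the
conditional variance of the bootstrap. -/
lemma variance_kde (hX : ∀ i, Measurable (X i)) (hind : iIndepFun X P) (hf : Measurable f)
    (hf0 : ∀ x, 0 ≤ f x)
    (hlaw : ∀ i, P.map (X i) = volume.withDensity fun x => ENNReal.ofReal (f x))
    (hψ : Measurable ψ) (hB : ∀ u, |ψ u| ≤ B) {n : ℕ} (hn : 1 ≤ n) {h : ℝ} (hh : 0 < h) :
    n * h * variance (kde ψ x₀ X n h) P =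
      kernelMean (fun u => ψ u ^ 2) f x₀ h - h * kernelMean ψ f x₀ h ^ 2 := by
  have hn' : (n : ℝ) ≠ 0 := by positivity
  have e : kde ψ x₀ X n h = fun ω => (n * h)⁻¹ *
      (∑ i ∈ Finset.Icc 1 n, fun ω => ψ ((X i ω - x₀) / h)) ω := by
    ext ω; simp [kde, Finset.sum_apply]
  have hm : Measurable fun y => ψ ((y - x₀) / h) := hψ.comp (by fun_prop)
  have hv : ∀ i, variance (fun ω => ψ ((X i ω - x₀) / h)) P =
      h * kernelMean (fun u => ψ u ^ 2) f x₀ h - (h * kernelMean ψ f x₀ h) ^ 2 := fun i => by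
    rw [variance_eq_sub (memLp_comp_rescale (hX i) hψ hB x₀ h),
      integral_comp_rescale (hX i) hf hf0 (hlaw i) hψ x₀ hh]
    simp only [Pi.pow_apply]
    rw [integral_comp_rescale (hX i) hf hf0 (hlaw i) (hψ.pow_const 2) x₀ hh]
  rw [e, variance_const_mul, IndepFun.variance_sum
    (fun i _ => memLp_comp_rescale (hX i) hψ hB x₀ h)
    (fun i _ j _ hij => (hind.indepFun hij).comp hm hm)]
  simp only [hv, Finset.sum_const, Nat.card_Icc, nsmul_eq_mul, Nat.add_sub_cancel]
  field_simp

/-- Chebyshev's inequality for kernel averages. -/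
lemma measureReal_lt_abs_kde_sub_le (hX : ∀ i, Measurable (X i)) (hind : iIndepFun X P)
    (hf : Measurable f) (hf0 : ∀ x, 0 ≤ f x) (hM : ∀ x, |f x| ≤ M)
    (hlaw : ∀ i, P.map (X i) = volume.withDensity fun x => ENNReal.ofReal (f x))
    (hψ : Measurable ψ) (hB : ∀ u, |ψ u| ≤ B) (hψ2 : Integrable fun u => ψ u ^ 2) {n : ℕ}
    (hn : 1 ≤ n) {h : ℝ} (hh : 0 < h) {t : ℝ} (ht : 0 < t) :
    P.real {ω | t * (n * h) ^ (-(1 / 2) : ℝ) < |kde ψ x₀ X n h ω - kernelMean ψ f x₀ h|} ≤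
      M * (∫ u, ψ u ^ 2) / t ^ 2 := by
  have hnh : 0 < n * h := by positivity
  have hv := variance_kde (x₀ := x₀) hX hind hf hf0 hlaw hψ hB hn hh
  have hle := (le_abs_self _).trans (abs_kernelMean_le hψ2 (fun u => sq_nonneg _) hf hM x₀ h)
  have hc := meas_ge_le_variance_div_sq (memLp_kde (x₀ := x₀) (P := P) hX hψ hB n h)
    (c := t * (n * h) ^ (-(1 / 2) : ℝ)) (by positivity)
  rw [integral_kde hX hf hf0 hlaw hψ hB hn hh] at hc
  have hsq : ((n * h) ^ (-(1 / 2) : ℝ)) ^ 2 = (n * h)⁻¹ := by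
    rw [← Real.rpow_natCast, ← Real.rpow_mul hnh.le, ← Real.rpow_neg_one]
    norm_num
  calc P.real {ω | t * (n * h) ^ (-(1 / 2) : ℝ) < |kde ψ x₀ X n h ω - kernelMean ψ f x₀ h|}
      ≤ P.real {ω | t * (n * h) ^ (-(1 / 2) : ℝ) ≤ |kde ψ x₀ X n h ω - kernelMean ψ f x₀ h|} :=
        measureReal_mono fun ω hω => by
          simp only [Set.mem_ofPred_eq] at hω ⊢; exact hω.le
    _ ≤ variance (kde ψ x₀ X n h) P / (t * (n * h) ^ (-(1 / 2) : ℝ)) ^ 2 :=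
        ENNReal.toReal_le_of_le_ofReal (div_nonneg (variance_nonneg _ _) (sq_nonneg _)) hc
    _ = (n * h * variance (kde ψ x₀ X n h) P) / t ^ 2 := by
        rw [mul_pow, hsq]; field_simp
    _ ≤ M * (∫ u, ψ u ^ 2) / t ^ 2 := by
        refine div_le_div_of_nonneg_right ?_ (sq_nonneg t)
        rw [hv]
        nlinarith [mul_nonneg hh.le (sq_nonneg (kernelMean ψ f x₀ h))]

end KernelAverages

/-! ### The bias of kernel averages -/

/-- The Lagrange remainder involves the fourth derivative, which is continuous at `x₀` and hence
bounded nearby. -/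
lemma abs_sub_taylor_four_le {f : ℝ → ℝ} {x₀ : ℝ} (hf : ContDiffAt ℝ 4 f x₀) :
    ∃ C : ℝ, ∃ δ > 0, ∀ t, |t| < δ →
      |f (x₀ + t) - (f x₀ + iteratedDeriv 1 f x₀ * t + iteratedDeriv 2 f x₀ * t ^ 2 / 2 +
        iteratedDeriv 3 f x₀ * t ^ 3 / 6)| ≤ C * t ^ 4 := by
  have hc : ContinuousAt (iteratedDeriv 4 f) x₀ := by
    have h := (hf.iteratedFDeriv_right (m := 0) (i := 4) (by norm_num)).continuousAt
    rw [iteratedDeriv_eq_equiv_comp]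
    exact (LinearIsometryEquiv.continuous _).continuousAt.comp h
  have hb : ∀ᶠ x in 𝓝 x₀, |iteratedDeriv 4 f x| ≤ |iteratedDeriv 4 f x₀| + 1 :=
    (hc.abs.eventually (gt_mem_nhds (lt_add_one _))).mono fun x hx => le_of_lt hx
  obtain ⟨δ, hδ, hball⟩ := Metric.eventually_nhds_iff.1 (hb.and (hf.eventually (by norm_num)))
  refine ⟨(|iteratedDeriv 4 f x₀| + 1) / 24, δ, hδ, fun t ht => ?_⟩
  rcases eq_or_ne t 0 with rfl | ht0
  · simp
  have hx : x₀ ≠ x₀ + t := by simpa using ht0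
  have hmem : ∀ y ∈ Set.uIcc x₀ (x₀ + t), dist y x₀ < δ := fun y hy => by
    have := Set.abs_sub_left_of_mem_uIcc hy
    rw [add_sub_cancel_left] at this
    exact this.trans_lt ht
  have hcd : ContDiffOn ℝ ((3 : ℕ) + 1) f (Set.uIcc x₀ (x₀ + t)) := fun y hy =>
    ((hball (hmem y hy)).2.of_le (by norm_num)).contDiffWithinAt
  obtain ⟨x', hx', he⟩ := taylor_mean_remainder_lagrange_iteratedDeriv hx hcd
  have hu := uniqueDiffOn_uIcc hx
  have hd : ∀ k : ℕ, k ≤ 3 → iteratedDerivWithin k f (Set.uIcc x₀ (x₀ + t)) x₀ =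
      iteratedDeriv k f x₀ := fun k hk =>
    iteratedDerivWithin_eq_iteratedDeriv hu
      (hf.of_le (by exact_mod_cast (hk.trans (by norm_num)))) Set.left_mem_uIcc
  rw [taylor_within_apply] at he
  simp only [Finset.sum_range_succ, Finset.sum_range_zero, zero_add] at he
  rw [hd 0 (by norm_num), hd 1 (by norm_num), hd 2 (by norm_num), hd 3 le_rfl] at he
  have h4 := (hball (hmem x' (Set.uIoo_subset_uIcc_self hx'))).1
  simp only [iteratedDeriv_zero, add_sub_cancel_left, smul_eq_mul, Nat.factorial,
    pow_zero] at he
  have e : f (x₀ + t) - (f x₀ + iteratedDeriv 1 f x₀ * t + iteratedDeriv 2 f x₀ * t ^ 2 / 2 +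
      iteratedDeriv 3 f x₀ * t ^ 3 / 6) = iteratedDeriv 4 f x' * t ^ 4 / 24 := by
    norm_num at he ⊢
    linarith
  rw [e, abs_div, abs_mul, abs_of_nonneg (by positivity : (0 : ℝ) ≤ t ^ 4),
    abs_of_pos (by norm_num : (0 : ℝ) < 24)]
  have : (0 : ℝ) ≤ t ^ 4 := by positivity
  have := mul_le_mul_of_nonneg_right h4 this
  linarith

/-- A global fourth order bound for the symmetrised second order Taylor expansion. -/
lemma abs_symmetrised_sub_taylor_le {f : ℝ → ℝ} {x₀ M : ℝ} (hf : ContDiffAt ℝ 4 f x₀)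
    (hM : ∀ x, |f x| ≤ M) :
    ∃ C, 0 ≤ C ∧ ∀ t, |(f (x₀ + t) + f (x₀ - t)) / 2 -
      (f x₀ + iteratedDeriv 2 f x₀ * t ^ 2 / 2)| ≤ C * t ^ 4 := by
  obtain ⟨C, δ, hδ, hC⟩ := abs_sub_taylor_four_le hf
  set D := |iteratedDeriv 2 f x₀|
  have hM0 : 0 ≤ M := (abs_nonneg _).trans (hM x₀)
  refine ⟨|C| + (2 * M / δ ^ 4 + D / δ ^ 2), by positivity, fun t => ?_⟩
  have ht4 : (0 : ℝ) ≤ t ^ 4 := by positivity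
  rcases lt_or_ge |t| δ with h | h
  -- Near `x₀`, averaging the expansions at `t` and `-t` cancels the first and third order terms.
  · have h1 := abs_le.1 (hC t h)
    have h2 := abs_le.1 (hC (-t) (by rwa [abs_neg]))
    have h3 : C * t ^ 4 ≤ (|C| + (2 * M / δ ^ 4 + D / δ ^ 2)) * t ^ 4 :=
      mul_le_mul_of_nonneg_right ((le_abs_self C).trans (le_add_of_nonneg_right (by positivity)))
        ht4
    rw [← sub_eq_add_neg] at h2
    rw [abs_le]
    constructor <;> nlinarith [h1.1, h1.2, h2.1, h2.2]
  -- Away from `x₀`, boundedness of `f` suffices: both `1` and `t ^ 2` are dominated by multiples of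
  -- `t ^ 4` once `|t| ≥ δ`.
  · have h1 : 1 ≤ |t| / δ := (one_le_div hδ).2 h
    have h2 : 1 ≤ t ^ 4 / δ ^ 4 := by
      have := one_le_pow₀ h1 (n := 4)
      rwa [div_pow, pow_abs, abs_of_nonneg ht4] at this
    have h3 : t ^ 2 ≤ t ^ 4 / δ ^ 2 := by
      have h5 : 1 ≤ t ^ 2 / δ ^ 2 := by
        have := one_le_pow₀ h1 (n := 2)
        rwa [div_pow, sq_abs] at this
      calc t ^ 2 = t ^ 2 * 1 := (mul_one _).symm
        _ ≤ t ^ 2 * (t ^ 2 / δ ^ 2) := mul_le_mul_of_nonneg_left h5 (sq_nonneg t)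
        _ = t ^ 4 / δ ^ 2 := by ring
    have a1 : |(f (x₀ + t) + f (x₀ - t)) / 2| ≤ M := by
      have := abs_le.1 (hM (x₀ + t))
      have := abs_le.1 (hM (x₀ - t))
      rw [abs_le]; constructor <;> linarith
    have a2 : |f x₀ + iteratedDeriv 2 f x₀ * t ^ 2 / 2| ≤ M + D * t ^ 2 := by
      refine (abs_add_le _ _).trans (add_le_add (hM _) ?_)
      rw [abs_div, abs_mul, abs_of_nonneg (sq_nonneg t), abs_two]
      have : 0 ≤ D * t ^ 2 := by positivity
      linarith
    have a3 := (abs_sub _ _).trans (add_le_add a1 a2)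
    have a4 : M * 1 ≤ M * (t ^ 4 / δ ^ 4) := mul_le_mul_of_nonneg_left h2 hM0
    have a5 : D * t ^ 2 ≤ D * (t ^ 4 / δ ^ 2) := mul_le_mul_of_nonneg_left h3 (abs_nonneg _)
    have a6 : 0 ≤ |C| * t ^ 4 := by positivity
    calc _ ≤ M + (M + D * t ^ 2) := a3
      _ ≤ |C| * t ^ 4 + (2 * (M * (t ^ 4 / δ ^ 4)) + D * (t ^ 4 / δ ^ 2)) := by linarith
      _ = _ := by ring

/-- The second order expansion of the mean of a kernel density estimator. -/
theorem abs_kernelMean_sub_le {K f : ℝ → ℝ} {x₀ M : ℝ} (hK : IsKernel K)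
    (hK4 : Integrable fun u => u ^ 4 * K u) (hf : ContDiffAt ℝ 4 f x₀) (hfm : Measurable f)
    (hM : ∀ x, |f x| ≤ M) :
    ∃ C, 0 ≤ C ∧ ∀ h, |kernelMean K f x₀ h -
      (f x₀ + h ^ 2 * iteratedDeriv 2 f x₀ * mu2 K / 2)| ≤ C * h ^ 4 := by
  obtain ⟨C, hC0, hC⟩ := abs_symmetrised_sub_taylor_le hf hM
  have hI0 : 0 ≤ ∫ u, u ^ 4 * K u :=
    integral_nonneg fun u => mul_nonneg (by positivity) (hK.nonneg u)
  refine ⟨C * ∫ u, u ^ 4 * K u, mul_nonneg hC0 hI0, fun h => ?_⟩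
  have i1 := integrable_mul_comp_affine hK.integrable hfm hM x₀ h
  have i2 : Integrable fun u => K u * f (x₀ - h * u) := by
    simpa [← sub_eq_add_neg] using integrable_mul_comp_affine hK.integrable hfm hM x₀ (-h)
  have i3 : Integrable fun u => K u * ((f (x₀ + h * u) + f (x₀ - h * u)) / 2) := by
    refine ((i1.add i2).div_const 2).congr (.of_forall fun u => ?_)
    simp only [Pi.add_apply]; ring
  -- Symmetry of `K` replaces `f` by its symmetrisation about `x₀`, to which the global fourth order
  -- bound applies.
  have e1 : kernelMean K f x₀ h = ∫ u, K u * ((f (x₀ + h * u) + f (x₀ - h * u)) / 2) := by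
    have e2 : ∫ u, K u * f (x₀ - h * u) = kernelMean K f x₀ h := by
      rw [kernelMean, ← integral_neg_eq_self]
      simp [hK.symmetric]
    have e3 : ∫ u, K u * ((f (x₀ + h * u) + f (x₀ - h * u)) / 2) =
        ((∫ u, K u * f (x₀ + h * u)) + ∫ u, K u * f (x₀ - h * u)) / 2 := by
      rw [← integral_add i1 i2, ← integral_div]
      congr 1; ext u; ring
    rw [e3, e2, ← kernelMean]; ring
  have i4 : Integrable fun u => f x₀ * K u + h ^ 2 * iteratedDeriv 2 f x₀ / 2 * (u ^ 2 * K u) :=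
    (hK.integrable.const_mul _).add (hK.integrable_sq_mul.const_mul _)
  have e4 : f x₀ + h ^ 2 * iteratedDeriv 2 f x₀ * mu2 K / 2 =
      ∫ u, f x₀ * K u + h ^ 2 * iteratedDeriv 2 f x₀ / 2 * (u ^ 2 * K u) := by
    rw [integral_add (hK.integrable.const_mul _) (hK.integrable_sq_mul.const_mul _),
      integral_const_mul, integral_const_mul, hK.integral_eq_one, mu2]
    ring
  rw [e1, e4, ← integral_sub i3 i4]
  calc _ ≤ ∫ u, |K u * ((f (x₀ + h * u) + f (x₀ - h * u)) / 2) -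
        (f x₀ * K u + h ^ 2 * iteratedDeriv 2 f x₀ / 2 * (u ^ 2 * K u))| :=
        abs_integral_le_integral_abs
    _ ≤ ∫ u, C * h ^ 4 * (u ^ 4 * K u) := by
        refine integral_mono (i3.sub i4).abs (hK4.const_mul _) fun u => ?_
        dsimp only
        have : K u * ((f (x₀ + h * u) + f (x₀ - h * u)) / 2) -
            (f x₀ * K u + h ^ 2 * iteratedDeriv 2 f x₀ / 2 * (u ^ 2 * K u)) =
            K u * ((f (x₀ + h * u) + f (x₀ - h * u)) / 2 -
              (f x₀ + iteratedDeriv 2 f x₀ * (h * u) ^ 2 / 2)) := by ring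
        rw [this, abs_mul, abs_of_nonneg (hK.nonneg u)]
        refine (mul_le_mul_of_nonneg_left (hC (h * u)) (hK.nonneg u)).trans_eq ?_
        ring
    _ = _ := by rw [integral_const_mul]; ring

/-! ### The conditional law of the bootstrap statistic given the sample -/

/-- By independence the conditional law of `Y` given `S` is the constant kernel `P.map Y`, so `S`
can be frozen and `Y` integrated out. -/
lemma condExp_comap_of_indepFun {Ω β γ : Type*} [MeasurableSpace Ω] [MeasurableSpace β]
    [MeasurableSpace γ] [StandardBorelSpace γ] [Nonempty γ] {P : Measure Ω} [IsProbabilityMeasure P]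
    {S : Ω → β} {Y : Ω → γ} (hS : Measurable S) (hY : Measurable Y) (h : IndepFun Y S P)
    {F : β × γ → ℝ} (hF : Measurable F) (hint : Integrable (fun ω => F (S ω, Y ω)) P) :
    P[fun ω => F (S ω, Y ω) | MeasurableSpace.comap S inferInstance] =ᵐ[P]
      fun ω => ∫ y, F (S ω, y) ∂(P.map Y) := by
  have := Measure.isProbabilityMeasure_map (μ := P) hY.aemeasurable
  have hk : condDistrib Y S P =ᵐ[P.map S] Kernel.const β (P.map Y) := by
    refine condDistrib_ae_eq_of_measure_eq_compProd S hY.aemeasurable ?_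
    rw [Measure.compProd_const]
    exact (indepFun_iff_map_prod_eq_prod_map_map hS.aemeasurable hY.aemeasurable).1 h.symm
  filter_upwards [condExp_prod_ae_eq_integral_condDistrib hS hY.aemeasurable hF.stronglyMeasurable
    hint, ae_of_ae_map hS.aemeasurable hk] with ω h1 h2
  rw [h1, h2, Kernel.const_apply]

lemma integral_uniformOn_Icc (n : ℕ) (g : ℕ → ℝ) :
    ∫ m, g m ∂(uniformOn (Set.Icc 1 n)) = (n : ℝ)⁻¹ * ∑ m ∈ Finset.Icc 1 n, g m := by
  have hc : Measure.count (Set.Icc 1 n) = n := by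
    rw [← Finset.coe_Icc, Measure.count_apply_finset]; simp
  have hi : IntegrableOn g (Finset.Icc 1 n : Set ℕ) Measure.count := by
    rw [← Set.biUnion_of_singleton (Finset.Icc 1 n : Set ℕ)]
    exact integrableOn_finset_iUnion.2 fun i _ => by simp
  rw [uniformOn, ProbabilityTheory.cond, integral_smul_measure, hc, ← Finset.coe_Icc,
    setIntegral_finset (Finset.Icc 1 n) hi]
  simp [Measure.real]

/-- The `m`-th coordinate of a vector with indices starting at one, and zero beyond it. -/
def coord {n : ℕ} (x : Fin n → ℝ) (m : ℕ) : ℝ := if h : m - 1 < n then x ⟨m - 1, h⟩ else 0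

lemma measurable_coord (n m : ℕ) : Measurable fun x : Fin n → ℝ => coord x m := by
  unfold coord
  split_ifs
  · exact measurable_pi_apply _
  · exact measurable_const

lemma coord_sample {Ω : Type*} (X : ℕ → Ω → ℝ) {n m : ℕ} (hm : m ∈ Set.Icc 1 n) (ω : Ω) :
    coord (sample X n ω) m = X m ω := by
  have h : m - 1 < n := by have := hm.1; have := hm.2; omega
  simp [coord, sample, h, Nat.sub_add_cancel hm.1]

/-- The bootstrap kernel estimator with block length one as a function of sample and indices. -/
noncomputable def resampleKde (K : ℝ → ℝ) (x₀ k : ℝ) {n b : ℕ} (p : (Fin n → ℝ) × (Fin b → ℕ)) :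
    ℝ :=
  (b : ℝ)⁻¹ * ∑ i, k⁻¹ * K ((coord p.1 (p.2 i) - x₀) / k)

lemma measurable_resampleKde {K : ℝ → ℝ} (hK : Measurable K) (x₀ k : ℝ) (n b : ℕ) :
    Measurable (resampleKde K x₀ k : (Fin n → ℝ) × (Fin b → ℕ) → ℝ) :=
  measurable_from_prod_countable_left fun j => (Finset.measurable_sum _ fun i _ =>
    (hK.comp (((measurable_coord n (j i)).sub_const x₀).div_const k)).const_mul _).const_mul _

lemma abs_resampleKde_le {K : ℝ → ℝ} {B : ℝ} (hB : ∀ u, |K u| ≤ B) (x₀ k : ℝ) {n b : ℕ}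
    (p : (Fin n → ℝ) × (Fin b → ℕ)) :
    |resampleKde K x₀ k p| ≤ (b : ℝ)⁻¹ * (b * (|k⁻¹| * B)) := by
  rw [resampleKde, abs_mul, abs_of_nonneg (by positivity : 0 ≤ (b : ℝ)⁻¹)]
  refine mul_le_mul_of_nonneg_left ((Finset.abs_sum_le_sum_abs _ _).trans ?_) (by positivity)
  refine (Finset.sum_le_sum (g := fun _ => |k⁻¹| * B) fun i _ => ?_).trans_eq (by simp)
  rw [abs_mul]
  exact mul_le_mul_of_nonneg_left (hB _) (abs_nonneg _)

section Conditional

variable {Ω : Type*} {K : ℝ → ℝ} {x₀ B : ℝ} {X : ℕ → Ω → ℝ} {n b : ℕ} {J : Fin b → Ω → ℕ}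

lemma bootKde_eq_resampleKde {ω : Ω} (hω : ∀ i, J i ω ∈ Set.Icc 1 n) (k : ℝ) :
    bootKde K x₀ X 1 J k ω = resampleKde K x₀ k (sample X n ω, fun i => J i ω) := by
  simp [bootKde, blockKde, resampleKde, coord_sample X (hω _)]

lemma kde_eq_sum_coord (ψ : ℝ → ℝ) (k : ℝ) (ω : Ω) :
    kde ψ x₀ X n k ω =
      (n : ℝ)⁻¹ * ∑ m ∈ Finset.Icc 1 n, k⁻¹ * ψ ((coord (sample X n ω) m - x₀) / k) := by
  rw [kde, mul_inv, ← Finset.mul_sum, mul_assoc]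
  congr 2
  refine Finset.sum_congr rfl fun m hm => ?_
  rw [coord_sample X (by simpa using hm)]

variable [MeasurableSpace Ω] {P : Measure Ω}

lemma measurable_sample (hX : ∀ i, Measurable (X i)) (n : ℕ) : Measurable (sample X n) :=
  measurable_pi_lambda _ fun _ => hX _

lemma IsBlockIndices.ae_mem (hJ : IsBlockIndices P X n 1 b J) (hn : 1 ≤ n) :
    ∀ᵐ ω ∂P, ∀ i, J i ω ∈ Set.Icc 1 n := by
  refine ae_all_iff.2 fun i => ae_of_ae_map (hJ.measurable i).aemeasurable
    (p := fun m => m ∈ Set.Icc 1 n) ?_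
  rw [hJ.uniform, Nat.sub_add_cancel hn]
  exact ae_cond_mem (Set.finite_Icc 1 n).measurableSet

lemma IsBlockIndices.map_eq_pi (hJ : IsBlockIndices P X n 1 b J) (hn : 1 ≤ n) :
    P.map (fun ω i => J i ω) = Measure.pi fun _ => uniformOn (Set.Icc 1 n) := by
  have h := hJ.independent.map_fun_eq_pi_map fun i => (hJ.measurable i).aemeasurable
  simp only [hJ.uniform, Nat.sub_add_cancel hn] at h
  exact h

variable [IsProbabilityMeasure P]

/-- With the sample frozen, each resampled term averages uniformly over all `n` observations. Blocks
of length one give every observation the same weight, so there is no edge effect. -/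
lemma condExp_bootKde (hX : ∀ i, Measurable (X i)) (hK : Measurable K) (hB : ∀ u, |K u| ≤ B)
    (hJ : IsBlockIndices P X n 1 b J) (hn : 1 ≤ n) (hb : 1 ≤ b) (k : ℝ) :
    P[bootKde K x₀ X 1 J k | sampleSigma X n] =ᵐ[P] kde K x₀ X n k := by
  have hJm : Measurable fun ω i => J i ω := measurable_pi_lambda _ hJ.measurable
  have hSm := measurable_sample hX n
  have hFm := measurable_resampleKde hK x₀ k n b
  have : IsProbabilityMeasure (uniformOn (Set.Icc 1 n)) :=
    isProbabilityMeasure_uniformOn (Set.finite_Icc 1 n) (Set.nonempty_Icc.2 hn)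
  have e : bootKde K x₀ X 1 J k =ᵐ[P]
      fun ω => resampleKde K x₀ k (sample X n ω, fun i => J i ω) := by
    filter_upwards [hJ.ae_mem hn] with ω hω using bootKde_eq_resampleKde hω k
  refine (condExp_congr_ae e).trans ((condExp_comap_of_indepFun hSm hJm hJ.indep_sample hFm
    (Integrable.of_bound (hFm.comp (hSm.prodMk hJm)).aestronglyMeasurable _
      (.of_forall fun ω => abs_resampleKde_le hB x₀ k _))).trans (.of_forall fun ω => ?_))
  dsimp only
  rw [hJ.map_eq_pi hn]
  simp only [resampleKde]
  rw [integral_const_mul, integral_finsetSum]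
  · have : ∀ i : Fin b, ∫ j : Fin b → ℕ, k⁻¹ * K ((coord (sample X n ω) (j i) - x₀) / k)
        ∂(Measure.pi fun _ => uniformOn (Set.Icc 1 n)) = kde K x₀ X n k ω := fun i => by
      rw [integral_comp_eval (μ := fun _ : Fin b => uniformOn (Set.Icc 1 n)) (i := i)
        (f := fun m => k⁻¹ * K ((coord (sample X n ω) m - x₀) / k))
        (measurable_of_countable _).aestronglyMeasurable, integral_uniformOn_Icc, kde_eq_sum_coord]
    simp only [this, Finset.sum_const, Finset.card_univ, Fintype.card_fin, nsmul_eq_mul]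
    rw [inv_mul_cancel_left₀ (by positivity)]
  · intro i _
    refine Integrable.of_bound (C := |k⁻¹| * B)
      (measurable_of_countable _).aestronglyMeasurable (.of_forall fun j => ?_)
    rw [norm_mul]
    exact mul_le_mul_of_nonneg_left (hB _) (abs_nonneg _)

/-- The conditional distribution function of the bootstrap statistic, in terms of i.i.d. uniform
indices. -/
lemma bootCDF_ae_eq (hX : ∀ i, Measurable (X i)) (hK : Measurable K) (hB : ∀ u, |K u| ≤ B)
    (hJ : IsBlockIndices P X n 1 b J) (hn : 1 ≤ n) (hb : 1 ≤ b) (τ k₁ k₂ k₃ y : ℝ) :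
    bootCDF P K x₀ X n 1 J τ k₁ k₂ k₃ y =ᵐ[P] fun ω =>
      (Measure.pi fun _ : Fin b => uniformOn (Set.Icc 1 n)).real
        {j | √(b * k₁) * (resampleKde K x₀ k₁ (sample X n ω, j) - kde K x₀ X n k₁ ω) +
          τ * (kde K x₀ X n k₂ ω - kde K x₀ X n k₃ ω) ≤ y} := by
  have hJm : Measurable fun ω i => J i ω := measurable_pi_lambda _ hJ.measurable
  have hSm := measurable_sample hX n
  set m : ℝ → (Fin n → ℝ) → ℝ := fun k x =>
    (n : ℝ)⁻¹ * ∑ m ∈ Finset.Icc 1 n, k⁻¹ * K ((coord x m - x₀) / k)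
  have hmm : ∀ k, Measurable (m k) := fun k => (Finset.measurable_sum _ fun i _ =>
    (hK.comp (((measurable_coord n i).sub_const x₀).div_const k)).const_mul _).const_mul _
  set G : (Fin n → ℝ) × (Fin b → ℕ) → ℝ := fun p =>
    √(b * k₁) * (resampleKde K x₀ k₁ p - m k₁ p.1) + τ * (m k₂ p.1 - m k₃ p.1)
  have hG : Measurable G :=
    (((measurable_resampleKde hK x₀ k₁ n b).sub ((hmm k₁).comp measurable_fst)).const_mul _).add
      ((((hmm k₂).comp measurable_fst).sub ((hmm k₃).comp measurable_fst)).const_mul _)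
  have hset : MeasurableSet {p | G p ≤ y} := measurableSet_le hG measurable_const
  set F : (Fin n → ℝ) × (Fin b → ℕ) → ℝ := {p | G p ≤ y}.indicator fun _ => 1
  have hF : Measurable F := measurable_const.indicator hset
  have e : ({ω | bootStat P K x₀ X n 1 J τ k₁ k₂ k₃ ω ≤ y}.indicator fun _ => (1 : ℝ)) =ᵐ[P]
      fun ω => F (sample X n ω, fun i => J i ω) := by
    filter_upwards [hJ.ae_mem hn, condExp_bootKde (x₀ := x₀) hX hK hB hJ hn hb k₁,
      condExp_bootKde (x₀ := x₀) hX hK hB hJ hn hb k₂] with ω h1 h2 h3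
    have : bootStat P K x₀ X n 1 J τ k₁ k₂ k₃ ω = G (sample X n ω, fun i => J i ω) := by
      simp only [bootStat, h2, h3, bootKde_eq_resampleKde h1, Nat.cast_one, mul_one, G, m,
        kde_eq_sum_coord]
    simp only [Set.indicator_apply, Set.mem_ofPred_eq, this, F]
  refine (condExp_congr_ae e).trans ((condExp_comap_of_indepFun hSm hJm hJ.indep_sample hF
    (Integrable.of_bound (C := 1) (hF.comp (hSm.prodMk hJm)).aestronglyMeasurable
      (.of_forall fun ω => ?_))).trans (.of_forall fun ω => ?_))
  · simp only [F, Set.indicator_apply]; split_ifs <;> simp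
  · dsimp only
    rw [hJ.map_eq_pi hn]
    have hm2 : MeasurableSet {j : Fin b → ℕ | G (sample X n ω, j) ≤ y} :=
      measurable_prodMk_left hset
    have : (fun j => F (sample X n ω, j)) =
        {j : Fin b → ℕ | G (sample X n ω, j) ≤ y}.indicator fun _ => 1 := rfl
    rw [this, integral_indicator_const _ hm2, smul_eq_mul, mul_one]
    simp only [G, m, kde_eq_sum_coord]

/-- The Berry–Esseen bound for the bootstrap, conditionally on the sample. -/
theorem ae_abs_bootCDF_sub_Phi_le (hX : ∀ i, Measurable (X i)) (hK : Measurable K)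
    (hK0 : ∀ u, 0 ≤ K u) (hB : ∀ u, K u ≤ B) (hJ : IsBlockIndices P X n 1 b J) (hn : 1 ≤ n)
    (hb : 1 ≤ b) {k₁ : ℝ} (hk₁ : 0 < k₁) (τ k₂ k₃ y : ℝ) :
    ∀ᵐ ω ∂P, ∀ s : ℝ, 0 < s →
      s ^ 2 = kde (fun u => K u ^ 2) x₀ X n k₁ ω - k₁ * kde K x₀ X n k₁ ω ^ 2 →
      |bootCDF P K x₀ X n 1 J τ k₁ k₂ k₃ y ω -
        Phi ((y - τ * (kde K x₀ X n k₂ ω - kde K x₀ X n k₃ ω)) / s)| ≤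
        16 * (B / (√(b * k₁) * s)) := by
  have hB' : ∀ u, |K u| ≤ B := fun u => by rw [abs_of_nonneg (hK0 u)]; exact hB u
  filter_upwards [bootCDF_ae_eq (x₀ := x₀) hX hK hB' hJ hn hb τ k₁ k₂ k₃ y] with ω hω s hs hs2
  rw [hω]
  have : IsProbabilityMeasure (uniformOn (Set.Icc 1 n)) :=
    isProbabilityMeasure_uniformOn (Set.finite_Icc 1 n) (Set.nonempty_Icc.2 hn)
  have hn0 : (0 : ℝ) < n := by positivity
  have hb0 : (0 : ℝ) < b := by positivity
  set r := √(b * k₁) with hr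
  have hr0 : 0 < r := Real.sqrt_pos.2 (by positivity)
  have hr2 : r ^ 2 = b * k₁ := Real.sq_sqrt (by positivity)
  set a : ℕ → ℝ := fun m => K ((coord (sample X n ω) m - x₀) / k₁) with ha
  set c := k₁ * kde K x₀ X n k₁ ω with hc
  have hmean : ∫ m, a m ∂(uniformOn (Set.Icc 1 n)) = c := by
    rw [integral_uniformOn_Icc, hc, kde_eq_sum_coord, ← Finset.mul_sum]
    field_simp
    rfl
  have hsq : ∫ m, a m ^ 2 ∂(uniformOn (Set.Icc 1 n)) = k₁ * kde (fun u => K u ^ 2) x₀ X n k₁ ω := by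
    rw [integral_uniformOn_Icc, kde_eq_sum_coord, ← Finset.mul_sum]
    field_simp
    rfl
  have hai : Integrable a (uniformOn (Set.Icc 1 n)) :=
    Integrable.of_bound (measurable_of_countable _).aestronglyMeasurable B
      (.of_forall fun m => hB' _)
  have hai2 : Integrable (fun m => a m ^ 2) (uniformOn (Set.Icc 1 n)) := by
    refine Integrable.of_bound (C := B ^ 2) (measurable_of_countable _).aestronglyMeasurable
      (.of_forall fun m => ?_)
    rw [norm_pow]
    exact pow_le_pow_left₀ (norm_nonneg _) (hB' _) 2
  have hc0 : 0 ≤ c := hmean ▸ integral_nonneg fun m => hK0 _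
  have hcB : c ≤ B := by
    rw [← hmean]
    refine (integral_mono hai (integrable_const B) fun m => hB _).trans_eq (by simp)
  -- Centred and scaled so that `b` draws have total variance one. Both `a m` and its mean `c` lie
  -- in `[0, B]`, so their difference is at most `B`.
  set g : ℕ → ℝ := fun m => (a m - c) / (r * s) with hg
  have hgd : ∀ m, |g m| ≤ B / (r * s) := fun m => by
    rw [hg, abs_div, abs_of_pos (mul_pos hr0 hs)]
    refine div_le_div_of_nonneg_right ?_ (by positivity)
    have h1 := hK0 ((coord (sample X n ω) m - x₀) / k₁)
    have h2 := hB ((coord (sample X n ω) m - x₀) / k₁)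
    rw [abs_le]
    constructor <;> simp only [ha] <;> linarith
  have hg0 : ∫ m, g m ∂(uniformOn (Set.Icc 1 n)) = 0 := by
    rw [hg, integral_div, integral_sub hai (integrable_const c), hmean]
    simp
  have hg1 : b * ∫ m, g m ^ 2 ∂(uniformOn (Set.Icc 1 n)) = 1 := by
    have e : ∀ m, g m ^ 2 = (a m ^ 2 - 2 * c * a m + c ^ 2) / (r * s) ^ 2 := fun m => by
      rw [hg]; ring
    have i1 : Integrable (fun m => a m ^ 2 - 2 * c * a m) (uniformOn (Set.Icc 1 n)) :=
      hai2.sub (hai.const_mul _)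
    simp_rw [e]
    rw [integral_div, integral_add i1 (integrable_const _), integral_sub hai2 (hai.const_mul _),
      integral_const_mul, hmean, hsq, mul_pow r s 2, hr2, hs2]
    simp only [integral_const, probReal_univ, one_smul]
    have : kde (fun u => K u ^ 2) x₀ X n k₁ ω - k₁ * kde K x₀ X n k₁ ω ^ 2 ≠ 0 := by
      rw [← hs2]; positivity
    rw [hc]
    field_simp
    ring
  have key := abs_measureReal_sum_le_sub_Phi_le (measurable_of_countable g) hgd hg0 hb hg1
    ((y - τ * (kde K x₀ X n k₂ ω - kde K x₀ X n k₃ ω)) / s)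
  have e : ∀ j : Fin b → ℕ, r * (resampleKde K x₀ k₁ (sample X n ω, j) - kde K x₀ X n k₁ ω) =
      s * ∑ i, g (j i) := fun j => by
    simp only [hg, resampleKde, ← Finset.sum_div, Finset.sum_sub_distrib, Finset.sum_const,
      Finset.card_univ, Fintype.card_fin, nsmul_eq_mul, ← Finset.mul_sum]
    have : kde K x₀ X n k₁ ω = c / k₁ := by rw [hc]; field_simp
    rw [this]
    field_simp
    rw [hr2]
  have hset : {j : Fin b → ℕ | r * (resampleKde K x₀ k₁ (sample X n ω, j) - kde K x₀ X n k₁ ω) +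
      τ * (kde K x₀ X n k₂ ω - kde K x₀ X n k₃ ω) ≤ y} =
      {j | ∑ i, g (j i) ≤ (y - τ * (kde K x₀ X n k₂ ω - kde K x₀ X n k₃ ω)) / s} := by
    ext j
    simp only [Set.mem_ofPred_eq]
    rw [e, le_div_iff₀ hs, le_sub_iff_add_le, mul_comm s]
  rw [hset]
  exact key

end Conditional

/-! ### From the Berry–Esseen bound to the expansion -/

lemma abs_sqrt_sub_sqrt_le {u v c : ℝ} (hc : 0 < c) (hu : c ^ 2 ≤ u) (hv : c ^ 2 ≤ v) :
    |√u - √v| ≤ |u - v| / c := by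
  have hu0 : 0 ≤ u := (sq_nonneg c).trans hu
  have hv0 : 0 ≤ v := (sq_nonneg c).trans hv
  have h1 : c ≤ √u := Real.le_sqrt_of_sq_le hu
  have h2 : 0 ≤ √v := Real.sqrt_nonneg v
  rw [le_div_iff₀ hc]
  calc |√u - √v| * c ≤ |√u - √v| * |√u + √v| := by
        gcongr
        exact (le_add_of_le_of_nonneg h1 h2).trans (le_abs_self _)
    _ = |u - v| := by
        rw [← abs_mul]
        congr 1
        nlinarith [Real.sq_sqrt hu0, Real.sq_sqrt hv0]

/-- The deterministic part of the comparison: the bootstrap distribution function is close to its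
normal approximation as soon as the kernel averages are close to their means. -/
lemma abs_sub_Phi_sqrt_le {p y τ A a m₁ m₂ m₃ e₁ e₂ e₃ k β c t r₁ r₂ r₃ M B d R : ℝ} (hc : 0 < c)
    (hd : 0 < d) (hB : 0 ≤ B) (hτ : 0 ≤ τ) (hk0 : 0 ≤ k) (hk1 : k ≤ 1) (hA : |A - a| ≤ t * r₁)
    (h₁ : |m₁ - e₁| ≤ t * r₁) (h₂ : |m₂ - e₂| ≤ t * r₂) (h₃ : |m₃ - e₃| ≤ t * r₃)
    (he₁ : |e₁| ≤ M) (htr : t * r₁ ≤ 1) (hsmall : t * r₁ * (2 + 2 * M) ≤ c ^ 2)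
    (hlow : 2 * c ^ 2 ≤ a - k * e₁ ^ 2) (hR : |e₂ - e₃ - β| ≤ R)
    (hp : ∀ s : ℝ, 0 < s → s ^ 2 = A - k * m₁ ^ 2 →
      |p - Phi ((y - τ * (m₂ - m₃)) / s)| ≤ 16 * (B / (d * s))) :
    |p - Phi ((y - τ * β) / √(a - k * e₁ ^ 2))| ≤
      16 * (B / (d * c)) + τ * (t * r₂ + t * r₃ + R) / c + t * r₁ * (2 + 2 * M) / c ^ 2 := by
  have htr0 : 0 ≤ t * r₁ := (abs_nonneg _).trans hA
  -- One unit of `t * r₁` comes from `A - a`. Factoring the difference of squares gives the other `1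
  -- + 2 * M`, from `|m₁ - e₁| ≤ 1` and `|e₁| ≤ M`.
  have hdiff : |(A - k * m₁ ^ 2) - (a - k * e₁ ^ 2)| ≤ t * r₁ * (2 + 2 * M) := by
    have e : (A - k * m₁ ^ 2) - (a - k * e₁ ^ 2) = (A - a) - k * ((m₁ - e₁) * (m₁ - e₁ + 2 * e₁)) := by
      ring
    have h4 : |m₁ - e₁ + 2 * e₁| ≤ 1 + 2 * M := by
      refine (abs_add_le _ _).trans (add_le_add (h₁.trans htr) ?_)
      rw [abs_mul, abs_two]; linarith
    have h5 : |(m₁ - e₁) * (m₁ - e₁ + 2 * e₁)| ≤ t * r₁ * (1 + 2 * M) := by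
      rw [abs_mul]; exact mul_le_mul h₁ h4 (abs_nonneg _) htr0
    have h6 : |k * ((m₁ - e₁) * (m₁ - e₁ + 2 * e₁))| ≤ t * r₁ * (1 + 2 * M) := by
      rw [abs_mul, abs_of_nonneg hk0]
      exact (mul_le_of_le_one_left (abs_nonneg _) hk1).trans h5
    rw [e]
    refine (abs_sub _ _).trans ((add_le_add hA h6).trans_eq ?_)
    ring
  set u := A - k * m₁ ^ 2
  set v := a - k * e₁ ^ 2
  have hu : c ^ 2 ≤ u := by linarith [(abs_le.1 hdiff).1]
  have hv : c ^ 2 ≤ v := by nlinarith [sq_nonneg c]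
  have hsu : c ≤ √u := Real.le_sqrt_of_sq_le hu
  have hsv : c ≤ √v := Real.le_sqrt_of_sq_le hv
  have hsu0 : 0 < √u := hc.trans_le hsu
  have p1 : |p - Phi ((y - τ * (m₂ - m₃)) / √u)| ≤ 16 * (B / (d * c)) := by
    refine (hp _ hsu0 (Real.sq_sqrt ((sq_nonneg c).trans hu))).trans ?_
    gcongr
  have p2 : |Phi ((y - τ * (m₂ - m₃)) / √u) - Phi ((y - τ * β) / √u)| ≤
      τ * (t * r₂ + t * r₃ + R) / c := by
    refine (abs_Phi_sub_le _ _).trans ?_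
    have e : (y - τ * (m₂ - m₃)) / √u - (y - τ * β) / √u =
        -(τ * ((m₂ - e₂) - (m₃ - e₃) + (e₂ - e₃ - β)) / √u) := by ring
    have h7 : |(m₂ - e₂) - (m₃ - e₃) + (e₂ - e₃ - β)| ≤ t * r₂ + t * r₃ + R :=
      (abs_add_le _ _).trans (add_le_add ((abs_sub _ _).trans (add_le_add h₂ h₃)) hR)
    rw [e, abs_neg, abs_div, abs_mul, abs_of_nonneg hτ, abs_of_pos hsu0]
    have : 0 ≤ t * r₂ + t * r₃ + R := (abs_nonneg _).trans h7
    gcongr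
  -- One factor `1 / c` comes from the scale bound for `Φ`, the other from the square root.
  have p3 : |Phi ((y - τ * β) / √u) - Phi ((y - τ * β) / √v)| ≤ t * r₁ * (2 + 2 * M) / c ^ 2 := by
    refine (abs_Phi_div_sub_le _ hc hsu hsv).trans ?_
    rw [sq, ← div_div]
    gcongr
    exact (abs_sqrt_sub_sqrt_le hc hu hv).trans (by gcongr)
  calc _ = |(p - Phi ((y - τ * (m₂ - m₃)) / √u)) +
        (Phi ((y - τ * (m₂ - m₃)) / √u) - Phi ((y - τ * β) / √u)) +
        (Phi ((y - τ * β) / √u) - Phi ((y - τ * β) / √v))| := by congr 1; ring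
    _ ≤ _ := (abs_add_three _ _ _).trans (by gcongr)

/-- The three error terms are bounded by a constant times the total rate. -/
lemma approximation_error_le {B c d q t C τ ℓ M r₁ r₂ r₃ x₂ x₃ : ℝ} (hc : 0 < c) (ht : 0 ≤ t)
    (hC : 0 ≤ C) (hτ : 0 ≤ τ) (hM : 0 ≤ M) (hB : 0 ≤ B) (hℓ : 0 ≤ ℓ) (hq : 0 ≤ q) (hx₂ : 0 ≤ x₂)
    (hx₃ : 0 ≤ x₃) (hr₂ : 0 ≤ r₂) (hr₃ : 0 ≤ r₃) (hqd : q = d⁻¹) (hr₁ : t * r₁ ≤ t * (ℓ * q)) :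
    16 * (B / (d * c)) + τ * (t * r₂ + t * r₃ + C * (x₂ + x₃)) / c +
      t * r₁ * (2 + 2 * M) / c ^ 2 ≤
      (16 * (B / c) + (t + C) / c + t * ℓ * (2 + 2 * M) / c ^ 2 + 1) *
        (q + τ * (x₂ + x₃ + r₂ + r₃)) := by
  have b1 : 16 * (B / (d * c)) = 16 * (B / c) * q := by
    rw [hqd, mul_comm d c, ← div_div, div_eq_mul_inv (B / c), mul_assoc]
  have b2 : τ * (t * r₂ + t * r₃ + C * (x₂ + x₃)) / c ≤
      (t + C) / c * (τ * (x₂ + x₃ + r₂ + r₃)) := by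
    rw [div_mul_eq_mul_div]
    refine div_le_div_of_nonneg_right ?_ hc.le
    have z1 : 0 ≤ τ * (t * (x₂ + x₃) + C * (r₂ + r₃)) := by positivity
    linarith
  have b3 : t * r₁ * (2 + 2 * M) / c ^ 2 ≤ t * ℓ * (2 + 2 * M) / c ^ 2 * q := by
    rw [div_mul_eq_mul_div]
    refine div_le_div_of_nonneg_right ?_ (sq_nonneg c)
    have := mul_le_mul_of_nonneg_right hr₁ (by positivity : 0 ≤ 2 + 2 * M)
    linarith
  set w := τ * (x₂ + x₃ + r₂ + r₃)
  have z2 : 0 ≤ w := by positivity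
  have z3 : 0 ≤ 16 * (B / c) * w := by positivity
  have z4 : 0 ≤ (t + C) / c * q := by positivity
  have z5 : 0 ≤ t * ℓ * (2 + 2 * M) / c ^ 2 * w := by positivity
  rw [b1]
  linarith

end KernelBootstrap

/-! ### Assembly of the expansion in probability -/

theorem theorem12 {Ω : Type*} [MeasurableSpace Ω] (P : Measure Ω) [IsProbabilityMeasure P]
    -- the i.i.d. data, with bounded density `f`, positive and `C⁴` at `x₀`
    (X : ℕ → Ω → ℝ) (hX : ∀ i, Measurable (X i)) (hX_indep : iIndepFun X P)
    (f : ℝ → ℝ) (hf_meas : Measurable f) (hf_nonneg : ∀ x, 0 ≤ f x)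
    (hf_bdd : ∃ M, ∀ x, |f x| ≤ M)
    (hf_law : ∀ i, P.map (X i) = volume.withDensity (fun x => ENNReal.ofReal (f x)))
    (x₀ : ℝ) (hf_pos : 0 < f x₀) (hf_smooth : ContDiffAt ℝ 4 f x₀)
    -- the kernel
    (K : ℝ → ℝ) (hK : IsKernel K) (hK_four : Integrable (fun u => u ^ 4 * K u))
    -- the number of blocks, the bandwidths and the factor `τ`
    (b : ℕ → ℕ) (τ k₁ k₂ k₃ : ℕ → ℝ)
    (hb_pos : ∀ n, 1 ≤ b n) (hτ : ∀ n, 0 ≤ τ n)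
    (hk₁_pos : ∀ n, 0 < k₁ n) (hk₂_pos : ∀ n, 0 < k₂ n) (hk₃_pos : ∀ n, 0 < k₃ n)
    (hb : (fun n => (b n : ℝ)) =O[atTop] (fun n : ℕ => (n : ℝ)))
    (hb_top : Tendsto b atTop atTop)
    (hk₁ : Tendsto (fun n => (b n * k₁ n)⁻¹ + k₁ n) atTop (𝓝 0))
    (hk₂ : Tendsto (fun n : ℕ => (n * k₂ n)⁻¹ + k₂ n) atTop (𝓝 0))
    (hk₃ : Tendsto (fun n : ℕ => (n * k₃ n)⁻¹ + k₃ n) atTop (𝓝 0))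
    -- the bootstrap indices, for block length `1`
    (J : (n : ℕ) → Fin (b n) → Ω → ℕ)
    (hJ : ∀ n, 1 ≤ n → IsBlockIndices P X n 1 (b n) (J n))
    (y : ℝ) :
    IsBigOInProb P
      (fun n ω => bootCDF P K x₀ X n 1 (J n) (τ n) (k₁ n) (k₂ n) (k₃ n) y ω -
        Phi ((y - τ n * (k₂ n ^ 2 - k₃ n ^ 2) * iteratedDeriv 2 f x₀ * mu2 K / 2) /
          sigma P K x₀ X n (k₁ n)))
      (fun n => (b n * k₁ n) ^ (-(1 / 2) : ℝ) +
        τ n * (k₂ n ^ 4 + k₃ n ^ 4 +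
          (n * k₂ n) ^ (-(1 / 2) : ℝ) + (n * k₃ n) ^ (-(1 / 2) : ℝ))) := by
  obtain ⟨M, hM⟩ := hf_bdd
  obtain ⟨B, hB⟩ := hK.bounded
  have hB0 : 0 ≤ B := (hK.nonneg 0).trans (hB 0)
  have hM0 : 0 ≤ M := (abs_nonneg _).trans (hM 0)
  have hBabs : ∀ u, |K u| ≤ B := fun u => by rw [abs_of_nonneg (hK.nonneg u)]; exact hB u
  have hB2abs : ∀ u, |K u ^ 2| ≤ B ^ 2 := fun u => by
    rw [abs_pow]; exact pow_le_pow_left₀ (abs_nonneg _) (hBabs u) 2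
  have hK2m : Measurable fun u => K u ^ 2 := hK.measurable.pow_const 2
  -- Chebyshev is also applied with `K²` as the kernel, which requires `K⁴` to be integrable.
  have hK4 : Integrable fun u => (K u ^ 2) ^ 2 := by
    simp_rw [sq (K _ ^ 2)]
    exact hK.integrable_sq.bdd_mul (c := B ^ 2) hK2m.aestronglyMeasurable (.of_forall hB2abs)
  have hI2 : 0 < ∫ u, K u ^ 2 := by
    refine (integral_nonneg fun u => sq_nonneg (K u)).lt_of_ne' fun h0 => ?_
    have h1 := (integral_eq_zero_iff_of_nonneg (fun u => sq_nonneg (K u)) hK.integrable_sq).1 h0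
    have h2 : ∫ u, K u = 0 := integral_eq_zero_of_ae (h1.mono fun u hu => by simpa using hu)
    rw [hK.integral_eq_one] at h2
    exact one_ne_zero h2
  have hI4 : 0 ≤ ∫ u, (K u ^ 2) ^ 2 := integral_nonneg fun u => sq_nonneg _
  obtain ⟨C, hC0, hC⟩ := abs_kernelMean_sub_le hK hK_four hf_smooth hf_meas hM
  -- limits of the bandwidths
  have hbk_pos : ∀ n, 0 < b n * k₁ n := fun n =>
    mul_pos (by exact_mod_cast hb_pos n) (hk₁_pos n)
  have hk₁0 : Tendsto k₁ atTop (𝓝 0) := squeeze_zero (fun n => (hk₁_pos n).le)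
    (fun n => le_add_of_nonneg_left (inv_nonneg.2 (hbk_pos n).le)) hk₁
  have hq : Tendsto (fun n => (b n * k₁ n) ^ (-(1 / 2) : ℝ)) atTop (𝓝 0) := by
    have h1 : Tendsto (fun n => (b n * k₁ n)⁻¹) atTop (𝓝 0) := squeeze_zero
      (fun n => inv_nonneg.2 (hbk_pos n).le) (fun n => le_add_of_nonneg_right (hk₁_pos n).le) hk₁
    have h2 := h1.sqrt
    rw [Real.sqrt_zero] at h2
    refine h2.congr fun n => ?_
    rw [Real.rpow_neg (hbk_pos n).le, ← Real.sqrt_eq_rpow, Real.sqrt_inv]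
  obtain ⟨L, hL0, hL⟩ := hb.exists_pos
  have hL := hL.bound
  -- The variance tends to `f x₀ * ∫ K²`, and `2 * c ^ 2` is half of this limit. The random variance
  -- may then deviate by `c ^ 2` and still be at least `c ^ 2`.
  set c : ℝ := √(f x₀ * (∫ u, K u ^ 2) / 4) with hcdef
  have hc : 0 < c := Real.sqrt_pos.2 (by positivity)
  have hc2 : 2 * c ^ 2 < f x₀ * ∫ u, K u ^ 2 := by
    rw [hcdef, Real.sq_sqrt (by positivity)]
    have := mul_pos hf_pos hI2
    linarith
  have hlow : ∀ᶠ n in atTop, 2 * c ^ 2 <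
      kernelMean (fun u => K u ^ 2) f x₀ (k₁ n) - k₁ n * kernelMean K f x₀ (k₁ n) ^ 2 := by
    have t1 := tendsto_kernelMean hK.integrable_sq hf_meas hM hf_smooth.continuousAt hk₁0
    have t2 := tendsto_kernelMean hK.integrable hf_meas hM hf_smooth.continuousAt hk₁0
    have t3 := t1.sub (hk₁0.mul (t2.pow 2))
    rw [zero_mul, sub_zero] at t3
    exact t3.eventually (lt_mem_nhds hc2)
  intro ε hε
  set V : ℝ := M * (∫ u, K u ^ 2) + M * ∫ u, (K u ^ 2) ^ 2 with hV
  have hV0 : 0 ≤ V := by positivity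
  -- There are four Chebyshev events, each of probability at most `V / t ^ 2`; this `t` brings their
  -- total to at most `ε`. The `+ 1` gives `t > 0` without needing `V > 0`.
  set t : ℝ := √(4 * (V + 1) / ε) with htdef
  have ht : 0 < t := Real.sqrt_pos.2 (by positivity)
  have ht2 : 4 * (V / t ^ 2) ≤ ε := by
    rw [htdef, Real.sq_sqrt (by positivity)]
    have : 4 * (V / (4 * (V + 1) / ε)) = ε * (V / (V + 1)) := by field_simp
    rw [this]
    exact mul_le_of_le_one_right hε.le ((div_le_one (by positivity)).2 (by linarith))
  refine ⟨16 * (B / c) + (t + C) / c + t * √L * (2 + 2 * M) / c ^ 2 + 1, by positivity, ?_⟩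
  -- The bound `c ^ 2` keeps the random variance away from zero; the bound `1` serves to linearise
  -- the squared mean.
  have hsmall : ∀ᶠ n in atTop, t * (√L * (b n * k₁ n) ^ (-(1 / 2) : ℝ)) * (2 + 2 * M) <
      min (c ^ 2) 1 := by
    have := ((hq.const_mul (√L)).const_mul t).mul_const (2 + 2 * M)
    simp only [mul_zero, zero_mul] at this
    exact this.eventually (gt_mem_nhds (by positivity))
  filter_upwards [hlow, hsmall, hL, eventually_ge_atTop 1, hk₁0.eventually (gt_mem_nhds one_pos)]
    with n hlow hsmall hL hn hk1
  have hn0 : (0 : ℝ) < n := by positivity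
  have hb0 : (0 : ℝ) < b n := by exact_mod_cast hb_pos n
  set q := (b n * k₁ n) ^ (-(1 / 2) : ℝ) with hqdef
  set r₁ := (n * k₁ n) ^ (-(1 / 2) : ℝ) with hr₁def
  set r₂ := (n * k₂ n) ^ (-(1 / 2) : ℝ) with hr₂def
  set r₃ := (n * k₃ n) ^ (-(1 / 2) : ℝ) with hr₃def
  have hq0 : 0 ≤ q := Real.rpow_nonneg (hbk_pos n).le _
  have hr₁0 : 0 ≤ r₁ := Real.rpow_nonneg (mul_pos hn0 (hk₁_pos n)).le _
  have hr₂0 : 0 ≤ r₂ := Real.rpow_nonneg (mul_pos hn0 (hk₂_pos n)).le _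
  have hr₃0 : 0 ≤ r₃ := Real.rpow_nonneg (mul_pos hn0 (hk₃_pos n)).le _
  have hqs : q = (√(b n * k₁ n))⁻¹ := by
    rw [hqdef, Real.rpow_neg (hbk_pos n).le, ← Real.sqrt_eq_rpow]
  -- Here `b ≤ L n` converts the sampling rate `(n k₁)^(-1/2)` into the resampling rate `(b
  -- k₁)^(-1/2)`.
  have hr₁q : r₁ ≤ √L * q := by
    have h1 : (b n : ℝ) ≤ L * n := by simpa using hL
    rw [hqs, hr₁def, Real.rpow_neg (mul_pos hn0 (hk₁_pos n)).le, ← Real.sqrt_eq_rpow,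
      ← div_eq_mul_inv, le_div_iff₀ (Real.sqrt_pos.2 (hbk_pos n)), mul_comm, ← div_eq_mul_inv,
      div_le_iff₀ (Real.sqrt_pos.2 (mul_pos hn0 (hk₁_pos n))), ← Real.sqrt_mul hL0.le]
    refine Real.sqrt_le_sqrt ?_
    rw [← mul_assoc]
    exact mul_le_mul_of_nonneg_right h1 (hk₁_pos n).le
  have htrq : t * r₁ ≤ t * (√L * q) := mul_le_mul_of_nonneg_left hr₁q ht.le
  have htr2 : t * r₁ * (2 + 2 * M) ≤ t * (√L * q) * (2 + 2 * M) :=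
    mul_le_mul_of_nonneg_right htrq (by positivity)
  have htr : t * r₁ ≤ 1 := by
    have h1 := htr2.trans (hsmall.le.trans (min_le_right _ _))
    nlinarith [mul_nonneg ht.le hr₁0]
  -- the sigma in the statement
  have hsig : sigma P K x₀ X n (k₁ n) =
      √(kernelMean (fun u => K u ^ 2) f x₀ (k₁ n) - k₁ n * kernelMean K f x₀ (k₁ n) ^ 2) := by
    rw [sigma, variance_kde hX hX_indep hf_meas hf_nonneg hf_law hK.measurable hBabs hn (hk₁_pos n)]
  have hbias : |kernelMean K f x₀ (k₂ n) - kernelMean K f x₀ (k₃ n) -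
      (k₂ n ^ 2 - k₃ n ^ 2) * iteratedDeriv 2 f x₀ * mu2 K / 2| ≤
      C * (k₂ n ^ 4 + k₃ n ^ 4) := by
    have h2 := abs_le.1 (hC (k₂ n))
    have h3 := abs_le.1 (hC (k₃ n))
    rw [abs_le]
    constructor <;> linarith [h2.1, h2.2, h3.1, h3.2]
  have he₁ : |kernelMean K f x₀ (k₁ n)| ≤ M := by
    simpa [hK.integral_eq_one] using
      abs_kernelMean_le hK.integrable hK.nonneg hf_meas hM x₀ (k₁ n)
  -- the exceptional events
  have hae := ae_abs_bootCDF_sub_Phi_le (x₀ := x₀) hX hK.measurable hK.nonneg hB (hJ n hn) hn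
    (hb_pos n) (hk₁_pos n) (τ n) (k₂ n) (k₃ n) y
  set N : Set Ω := {ω | ¬ ∀ s : ℝ, 0 < s →
      s ^ 2 = kde (fun u => K u ^ 2) x₀ X n (k₁ n) ω - k₁ n * kde K x₀ X n (k₁ n) ω ^ 2 →
      |bootCDF P K x₀ X n 1 (J n) (τ n) (k₁ n) (k₂ n) (k₃ n) y ω -
        Phi ((y - τ n * (kde K x₀ X n (k₂ n) ω - kde K x₀ X n (k₃ n) ω)) / s)| ≤
        16 * (B / (√(b n * k₁ n) * s))} with hNdef
  have hN : P.real N = 0 := by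
    rw [Measure.real, show P N = 0 from ae_iff.1 hae, ENNReal.toReal_zero]
  set E : (ℝ → ℝ) → ℝ → Set Ω := fun ψ h =>
    {ω | t * (n * h) ^ (-(1 / 2) : ℝ) < |kde ψ x₀ X n h ω - kernelMean ψ f x₀ h|} with hEdef
  have hEK : ∀ h, 0 < h → P.real (E K h) ≤ V / t ^ 2 := fun h hh =>
    (measureReal_lt_abs_kde_sub_le hX hX_indep hf_meas hf_nonneg hM hf_law hK.measurable hBabs
      hK.integrable_sq hn hh ht).trans
      (div_le_div_of_nonneg_right (le_add_of_nonneg_right (by positivity)) (sq_nonneg t))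
  have hEK2 : P.real (E (fun u => K u ^ 2) (k₁ n)) ≤ V / t ^ 2 :=
    (measureReal_lt_abs_kde_sub_le hX hX_indep hf_meas hf_nonneg hM hf_law hK2m hB2abs
      hK4 hn (hk₁_pos n) ht).trans
      (div_le_div_of_nonneg_right (le_add_of_nonneg_left (by positivity)) (sq_nonneg t))
  -- Off a null set and the four Chebyshev events the deterministic comparison applies, so a large
  -- error can only occur inside their union.
  refine (measureReal_mono (s₂ := N ∪ (E (fun u => K u ^ 2) (k₁ n) ∪ (E K (k₁ n) ∪
    (E K (k₂ n) ∪ E K (k₃ n))))) fun ω hω => ?_).trans ?_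
  · by_contra hcon
    simp only [hNdef, hEdef, Set.mem_union, Set.mem_ofPred_eq, not_or, not_not, not_lt] at hcon hω
    obtain ⟨g0, g1, g2, g3, g4⟩ := hcon
    have key := abs_sub_Phi_sqrt_le hc (Real.sqrt_pos.2 (hbk_pos n)) hB0 (hτ n) (hk₁_pos n).le
      hk1.le g1 g2 g3 g4 he₁ htr (htr2.trans (hsmall.le.trans (min_le_left _ _))) hlow.le hbias g0
    rw [hsig] at hω
    have e : τ n * (k₂ n ^ 2 - k₃ n ^ 2) * iteratedDeriv 2 f x₀ * mu2 K / 2 =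
        τ n * ((k₂ n ^ 2 - k₃ n ^ 2) * iteratedDeriv 2 f x₀ * mu2 K / 2) := by ring
    rw [e] at hω
    refine absurd (hω.trans_le key) (not_lt.2 ?_)
    refine approximation_error_le hc ht.le hC0 (hτ n) hM0 hB0 (Real.sqrt_nonneg L) hq0
      (by have := hk₂_pos n; positivity) (by have := hk₃_pos n; positivity) hr₂0 hr₃0 hqs htrq
  · have u1 := measureReal_union_le (μ := P) N (E (fun u => K u ^ 2) (k₁ n) ∪ (E K (k₁ n) ∪
      (E K (k₂ n) ∪ E K (k₃ n))))
    have u2 := measureReal_union_le (μ := P) (E (fun u => K u ^ 2) (k₁ n)) (E K (k₁ n) ∪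
      (E K (k₂ n) ∪ E K (k₃ n)))
    have u3 := measureReal_union_le (μ := P) (E K (k₁ n)) (E K (k₂ n) ∪ E K (k₃ n))
    have u4 := measureReal_union_le (μ := P) (E K (k₂ n)) (E K (k₃ n))
    have v1 := hEK _ (hk₁_pos n)
    have v2 := hEK _ (hk₂_pos n)
    have v3 := hEK _ (hk₃_pos n)
    linarith
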